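/- Fix $\sigma,\alpha,\nu>0$, a matrix $M\in SL(d,\mathbb R)$, a nonempty bounded open set $\Omega\subset\mathbb R^d$ and a nonzero vector $h\in\mathbb R^d$. Let $Y$ be a mean zero, geometric anisotropic $d$-dimensional Matérn Gaussian random field with parameters $(\sigma,\alpha,\nu,M)$, that is, a mean zero Gaussian field with $\mathrm{cov}(Y(s),Y(t))=K(|Ms-Mt|)$, where $|\cdot|$ is the Euclidean norm, $$K(t)=\frac{\sigma^2(\alpha t)^\nu}{\Gamma(\nu)2^{\nu-1}}\,\mathcal K_\nu(\alpha t)\quad(t>0),\qquad K(0)=\sigma^2,$$ and $\mathcal K_\nu$ is the modified Bessel function of the second kind. Put $\Omega_n=\Omega\cap(\mathbb Z^d/n)$, $\Delta_uY(t)=Y(t+u)-Y(t)$, $\Delta_u^m=\Delta_u\Delta_u^{m-1}$, and $$Q_n^m=\frac1{\#\Omega_n}\sum_{j\in\Omega_n}n^{2\nu}\bigl(\Delta_{h/n}^mY(j)\bigr)^2 .$$ Let $G_\nu(0)=0$ and, for $t>0$, $$G_\nu(t)=\frac{(-1)^{\nu+1}}{2^{2\nu-1}\Gamma(\nu)\Gamma(\nu+1)}t^{2\nu}\log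 t\ \ (\nu\in\mathbb Z),\qquad G_\nu(t)=\frac{-\pi}{2^{2\nu}\sin(\nu\pi)\Gamma(\nu)\Gamma(\nu+1)}t^{2\nu}\ \ (\nu\notin\mathbb Z),$$ and set $S_\nu^m=\sum_{i,j=0}^m(-1)^{i+j}\binom mi\binom mj G_\nu(|i-j|)$, $$a_\nu^m=\sigma^2\alpha^{2\nu}|Mh|^{2\nu}S_\nu^m,\qquad b_\nu^m=-\nu\,\sigma^2\alpha^{2\nu+2}|Mh|^{2\nu+2}S_{\nu+1}^m .$$ Let $p\ne q$ be positive integers with $p,q>\nu+1$, $4<\min\{2p-2\nu,d\}$ and $4<\min\{2q-2\nu,d\}$, and suppose that $Y$ is defined on a region which, for all large $n$, contains the points $j+kh/n$ with $j\in\Omega_n$, $0\le k\le\max\{p,q\}$. Then $a_\nu^q\neq0$ and, with probability one, $$n^2\Bigl[Q_n^p-\frac{a_\nu^p}{a_\nu^q}Q_n^q\Bigr]\longrightarrow b_\nu^p-\frac{a_\nu^p}{a_\nu^q}b_\nu^q\qquad(n\to\infty).$$ Moreover the limit is a known multiple of $\sigma^2\alpha^{2\nu+2}|Mh|^{2\nu+2}$: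 $$b_\nu^p-\frac{a_\nu^p}{a_\nu^q}b_\nu^q=c\,\sigma^2\alpha^{2\nu+2}|Mh|^{2\nu+2},\qquad c=-\nu\Bigl(S_{\nu+1}^p-\frac{S_\nu^p}{S_\nu^q}S_{\nu+1}^q\Bigr),$$ where $c$ depends only on $\nu,p,q$. -/

import Mathlib

open MeasureTheory ProbabilityTheory Filter Topology

noncomputable section

/-- The modified Bessel function of the second kind of order `ν`, at `x > 0`, in its classical
integral form `K_ν(x) = ∫_0^∞ exp (-x cosh u) cosh (ν u) du`. -/
def besselK (ν x : ℝ) : ℝ :=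
  ∫ u in Set.Ioi (0 : ℝ), Real.exp (-x * Real.cosh u) * Real.cosh (ν * u)

/-- The isotropic Matérn autocovariance with variance `σ ^ 2`, scale `α` and smoothness `ν`, as a
function of the distance `t ≥ 0`; its value at `t = 0` is the limit `σ ^ 2`. -/
def maternCov (σ α ν t : ℝ) : ℝ :=
  if t = 0 then σ ^ 2
  else σ ^ 2 * (α * t) ^ ν / (Real.Gamma ν * 2 ^ (ν - 1)) * besselK ν (α * t)

/-- `Y` is, on the region `D ⊆ ℝ^d`, a mean zero geometric anisotropic Matérn Gaussian random field
with parameters `(σ, α, ν, M)`: a Gaussian process indexed by `D` with mean zero and covariance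
`cov (Y s, Y t) = K (|M s - M t|)`, where `K` is the isotropic Matérn autocovariance. The values of
`Y` outside `D` are irrelevant. -/
structure IsMaternField {d : ℕ} {S : Type*} [MeasurableSpace S] (P : Measure S)
    (σ α ν : ℝ) (M : Matrix (Fin d) (Fin d) ℝ) (D : Set (EuclideanSpace ℝ (Fin d)))
    (Y : EuclideanSpace ℝ (Fin d) → S → ℝ) : Prop where
  gaussian : IsGaussianProcess (fun t : D => Y t) P
  mean_zero : ∀ t ∈ D, ∫ ω, Y t ω ∂P = 0
  cov_eq : ∀ s ∈ D, ∀ t ∈ D,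
    covariance (Y s) (Y t) P =
      maternCov σ α ν ‖Matrix.toEuclideanLin M s - Matrix.toEuclideanLin M t‖

/-- The grid `Ω_n = Ω ∩ (ℤ^d / n)`. -/
def gridPoints {d : ℕ} (Ω : Set (EuclideanSpace ℝ (Fin d))) (n : ℕ) :
    Set (EuclideanSpace ℝ (Fin d)) :=
  {x | x ∈ Ω ∧ ∃ z : Fin d → ℤ, ∀ i, x i = (z i : ℝ) / (n : ℝ)}

/-- The quadratic variation `Q_n^m` of a sample path `y` with increments of order `m` in the
direction `h / n`:
`Q_n^m = (1 / #Ω_n) ∑_{j ∈ Ω_n} n ^ (2 ν) (Δ_{h/n}^m y (j)) ^ 2`, with `Δ_h y (t) = y (t + h) - y t`.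
For bounded `Ω` and `n ≥ 1` the grid `Ω_n` is finite. -/
def quadVar {d : ℕ} (ν : ℝ) (Ω : Set (EuclideanSpace ℝ (Fin d))) (h : EuclideanSpace ℝ (Fin d))
    (m n : ℕ) (y : EuclideanSpace ℝ (Fin d) → ℝ) : ℝ :=
  1 / ((gridPoints Ω n).ncard : ℝ) *
    ∑ᶠ j ∈ gridPoints Ω n,
      (n : ℝ) ^ (2 * ν) * ((fwdDiff ((n : ℝ)⁻¹ • h))^[m] y j) ^ 2

open Classical in
/-- The principal irregular term `G_ν` of the Matérn covariance, for `ν > 0` and `t ≥ 0`. With the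
conventions for `Real.log` and `Real.rpow` at `0` it satisfies `G_ν(0) = 0`. -/
def irregularTerm (ν t : ℝ) : ℝ :=
  if ∃ k : ℤ, ν = k then
    (-1) ^ (⌊ν⌋₊ + 1) / (2 ^ (2 * ν - 1) * Real.Gamma ν * Real.Gamma (ν + 1))
      * (t ^ (2 * ν) * Real.log t)
  else
    -Real.pi / (2 ^ (2 * ν) * Real.sin (ν * Real.pi) * Real.Gamma ν * Real.Gamma (ν + 1))
      * t ^ (2 * ν)

/-- `∑_{i,j=0}^m (-1)^(i+j) (m choose i) (m choose j) G_ν(|i - j|)`. -/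
def irregularSum (ν : ℝ) (m : ℕ) : ℝ :=
  ∑ i ∈ Finset.range (m + 1), ∑ j ∈ Finset.range (m + 1),
    (-1) ^ (i + j) * (m.choose i : ℝ) * (m.choose j : ℝ) * irregularTerm ν |(i : ℝ) - (j : ℝ)|

/-- The first coefficient `a_ν^m`. -/
def coeffA {d : ℕ} (σ α ν : ℝ) (M : Matrix (Fin d) (Fin d) ℝ) (h : EuclideanSpace ℝ (Fin d))
    (m : ℕ) : ℝ :=
  σ ^ 2 * α ^ (2 * ν) * ‖Matrix.toEuclideanLin M h‖ ^ (2 * ν) * irregularSum ν m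

/-- The second coefficient `b_ν^m`. -/
def coeffB {d : ℕ} (σ α ν : ℝ) (M : Matrix (Fin d) (Fin d) ℝ) (h : EuclideanSpace ℝ (Fin d))
    (m : ℕ) : ℝ :=
  σ ^ 2 * α ^ (2 * ν + 2) * ‖Matrix.toEuclideanLin M h‖ ^ (2 * ν + 2)
    * (-ν * irregularSum (ν + 1) m)

/-- The known factor, depending on `ν`, `p`, `q` only, in front of
`σ ^ 2 α ^ (2 ν + 2) |M h| ^ (2 ν + 2)` in `b_ν^p - (a_ν^p / a_ν^q) b_ν^q`. -/
def contrastConst (ν : ℝ) (p q : ℕ) : ℝ :=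
  -ν * (irregularSum (ν + 1) p
    - irregularSum ν p / irregularSum ν q * irregularSum (ν + 1) q)

end

/-! The Matérn covariance is a mixture of Gaussian kernels `exp (-v y²)` with weight `v ^ (-ν - 1) *
exp (-(α c)² / (4 v))`, where `c` is the length scale. With `r = |M h|` and `c = r / n`, the factor
`n ^ (2 ν)` cancels the scale in front. Up to a constant, the variance of a scaled increment is then
the integral of `v ^ (-ν - 1) * exp (-b / (n² v)) * D v`, where `b = (α r)² / 4` and `D` is the
alternating double sum of the Gaussian kernel. As `D v = O(v ^ m)` at `0` and `ν + 1 < m`, the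
second exponential may be expanded to order `n⁻²` under the integral. The two coefficients are
Mellin transforms of `D` at `-ν` and `-ν - 1`; integration by parts identifies them with the
irregular sums, which gives `a` and `b` (`integral_rpow_mul_altSum`,
`tendsto_sq_mul_altSum_matern_sub`). Positive definiteness gives `D ≥ 0`, hence `a ≠ 0`.

For the fluctuations, the mixture also shows that covariances of scaled increments decay like `(1 +
|w|) ^ (-κ)` in the rescaled lag `w`, for every nonnegative `κ < 2 (m - ν)`
(`exists_abs_altSum_matern_le`). With `κ = 9 / 4`, the squared covariances over the grid sum to `O(n
^ (2 d - 9 / 2))`. A centred Gaussian quadratic form has eighth moment bounded by the fourth power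
of that sum (`lintegral_quadratic_pow_le`), so `n² (Q - E Q)` has eighth moment `O(n⁻²)`. This is
summable, so it tends to `0` almost surely. In the contrast of the two orders the `a` terms cancel
and the `b` terms remain. -/

/-! ### The Matérn covariance as a Gaussian scale mixture -/

theorem integrableOn_invGamma {ν e : ℝ} (hν : 0 < ν) (he : 0 < e) :
    IntegrableOn (fun v : ℝ => v ^ (-ν - 1) * Real.exp (-e / v)) (Set.Ioi 0) := by
  have h := (integrableOn_Ioi_comp_rpow_iff
    (fun v : ℝ => v ^ (ν - 1) * Real.exp (-e * v ^ (1 : ℝ))) (p := -1) (by norm_num)).2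
    (integrableOn_rpow_mul_exp_neg_mul_rpow (by linarith) one_pos he)
  refine h.congr_fun (fun v hv => ?_) measurableSet_Ioi
  have hv' : (0 : ℝ) < v := hv
  simp only [abs_neg, abs_one, one_mul, smul_eq_mul, Real.rpow_one]
  rw [← Real.rpow_mul hv'.le, ← mul_assoc, ← Real.rpow_add hv', Real.rpow_neg_one]
  congr 2
  ring

theorem integral_invGamma {ν e : ℝ} (hν : 0 < ν) (he : 0 < e) :
    ∫ v in Set.Ioi (0 : ℝ), v ^ (-ν - 1) * Real.exp (-e / v) = (1 / e) ^ ν * Real.Gamma ν := by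
  rw [← Real.integral_rpow_mul_exp_neg_mul_Ioi hν he,
    ← integral_comp_rpow_Ioi (fun v : ℝ => v ^ (ν - 1) * Real.exp (-(e * v))) (p := -1)
      (by norm_num)]
  refine setIntegral_congr_fun measurableSet_Ioi (fun v hv => ?_)
  have hv' : (0 : ℝ) < v := hv
  simp only [abs_neg, abs_one, one_mul, smul_eq_mul]
  rw [← Real.rpow_mul hv'.le, ← mul_assoc, ← Real.rpow_add hv', Real.rpow_neg_one]
  congr 2
  · ring
  · ring

theorem integrableOn_maternMixture {ν e : ℝ} (hν : 0 < ν) (he : 0 < e) {x : ℝ} (hx : 0 ≤ x) :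
    IntegrableOn (fun v : ℝ => v ^ (-ν - 1) * Real.exp (-e / v) * Real.exp (-v * x))
      (Set.Ioi 0) := by
  refine (integrableOn_invGamma hν he).mono' (by fun_prop) ?_
  refine (ae_restrict_iff' measurableSet_Ioi).2 (Eventually.of_forall fun v (hv : 0 < v) => ?_)
  rw [Real.norm_of_nonneg (by positivity)]
  refine mul_le_of_le_one_right (by positivity) ?_
  rw [Real.exp_le_one_iff]
  nlinarith [mul_nonneg hv.le hx]

/-- The substitution `v = e / (2 y) * exp u` turns `e² / (4 v) + v y²` into `e y cosh u`. The
resulting integral over the line folds at `0`, where `exp (-ν u)` and `exp (ν u)` add up to `2 cosh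
(ν u)`. -/
theorem besselK_eq_integral {ν e y : ℝ} (hν : 0 < ν) (he : 0 < e) (hy : 0 < y) :
    besselK ν (e * y) = 1 / 2 * (e / (2 * y)) ^ ν *
      ∫ v in Set.Ioi (0 : ℝ), v ^ (-ν - 1) * Real.exp (-(e ^ 2 / 4) / v)
        * Real.exp (-v * y ^ 2) := by
  set A : ℝ := e / (2 * y) with hA
  have hA0 : 0 < A := by positivity
  set G : ℝ → ℝ := fun v => v ^ (-ν - 1) * Real.exp (-(e ^ 2 / 4) / v) * Real.exp (-v * y ^ 2)
    with hG
  have himg : (fun u : ℝ => A * Real.exp u) '' Set.univ = Set.Ioi 0 := by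
    ext v
    constructor
    · rintro ⟨u, -, rfl⟩
      exact mul_pos hA0 (Real.exp_pos u)
    · intro hv
      refine ⟨Real.log (v / A), trivial, ?_⟩
      simp only
      rw [Real.exp_log (div_pos hv hA0)]
      field_simp
  have hder : ∀ u ∈ (Set.univ : Set ℝ),
      HasDerivWithinAt (fun u : ℝ => A * Real.exp u) (A * Real.exp u) Set.univ u := fun u _ =>
    ((Real.hasDerivAt_exp u).const_mul A).hasDerivWithinAt
  have hinj : Set.InjOn (fun u : ℝ => A * Real.exp u) Set.univ := fun u _ w _ h =>
    Real.exp_injective (mul_left_cancel₀ hA0.ne' h)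
  have hpt : ∀ u : ℝ, |A * Real.exp u| • G (A * Real.exp u)
      = A ^ (-ν) * (Real.exp (-ν * u) * Real.exp (-(e * y) * Real.cosh u)) := by
    intro u
    have h1 : 0 < A * Real.exp u := by positivity
    rw [abs_of_pos h1, smul_eq_mul, hG]
    simp only
    have h2 : A * Real.exp u * (A * Real.exp u) ^ (-ν - 1) = A ^ (-ν) * Real.exp (-ν * u) := by
      rw [Real.rpow_sub_one h1.ne', mul_div_cancel₀ _ h1.ne', Real.mul_rpow hA0.le (by positivity),
        ← Real.exp_mul, mul_comm u]
    rw [← mul_assoc, ← mul_assoc, h2, mul_assoc, ← Real.exp_add, mul_assoc]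
    congr 3
    rw [Real.cosh_eq, Real.exp_neg, hA]
    have := Real.exp_pos u
    field_simp
    ring
  have hint : ∫ v in Set.Ioi (0 : ℝ), G v
      = A ^ (-ν) * ∫ u : ℝ, Real.exp (-ν * u) * Real.exp (-(e * y) * Real.cosh u) := by
    rw [← himg, integral_image_eq_integral_abs_deriv_smul MeasurableSet.univ hder hinj,
      Measure.restrict_univ, ← integral_const_mul]
    exact integral_congr_ae (Eventually.of_forall hpt)
  have hinteg : Integrable (fun u : ℝ => Real.exp (-ν * u) * Real.exp (-(e * y) * Real.cosh u)) := by
    have h0 : IntegrableOn G (Set.Ioi 0) :=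
      integrableOn_maternMixture hν (by positivity) (by positivity)
    rw [← himg, integrableOn_image_iff_integrableOn_abs_deriv_smul MeasurableSet.univ hder hinj,
      integrableOn_univ] at h0
    have h1 := (h0.congr (Eventually.of_forall hpt)).const_mul (A ^ ν)
    refine h1.congr (Eventually.of_forall fun u => ?_)
    simp only
    rw [← mul_assoc, ← Real.rpow_add hA0, add_neg_cancel, Real.rpow_zero, one_mul]
  have hfold : ∫ u : ℝ, Real.exp (-ν * u) * Real.exp (-(e * y) * Real.cosh u)
      = 2 * besselK ν (e * y) := by
    rw [← intervalIntegral.integral_Iic_add_Ioi (b := 0) hinteg.integrableOn hinteg.integrableOn]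
    have h1 : ∫ u in Set.Iic (0 : ℝ), Real.exp (-ν * u) * Real.exp (-(e * y) * Real.cosh u)
        = ∫ u in Set.Ioi (0 : ℝ), Real.exp (ν * u) * Real.exp (-(e * y) * Real.cosh u) := by
      have := integral_comp_neg_Iic (0 : ℝ)
        (fun u => Real.exp (ν * u) * Real.exp (-(e * y) * Real.cosh u))
      rw [neg_zero] at this
      rw [← this]
      simp [Real.cosh_neg]
    have hneg : IntegrableOn (fun u : ℝ => Real.exp (ν * u) * Real.exp (-(e * y) * Real.cosh u))
        (Set.Ioi 0) := by
      have := hinteg.comp_neg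
      simp only [Real.cosh_neg, mul_neg, neg_mul, neg_neg] at this
      simp only [neg_mul]
      exact this.integrableOn
    rw [h1, ← integral_add hneg hinteg.integrableOn, besselK, ← integral_const_mul]
    refine integral_congr_ae (Eventually.of_forall fun u => ?_)
    simp only
    rw [Real.cosh_eq (ν * u), neg_mul ν u]
    ring
  rw [hint, hfold, Real.rpow_neg hA0.le]
  have : A ^ ν ≠ 0 := (Real.rpow_pos_of_pos hA0 ν).ne'
  field_simp

/-- The Matérn covariance is a scale mixture of Gaussian kernels. -/
theorem maternCov_eq_mixture {σ α ν c y : ℝ} (hα : 0 < α) (hν : 0 < ν) (hc : 0 < c) (hy : 0 ≤ y) :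
    maternCov σ α ν (c * y) = σ ^ 2 * (α * c) ^ (2 * ν) / (Real.Gamma ν * 4 ^ ν) *
      ∫ v in Set.Ioi (0 : ℝ), v ^ (-ν - 1) * Real.exp (-((α * c) ^ 2 / 4) / v)
        * Real.exp (-v * y ^ 2) := by
  have he : 0 < α * c := by positivity
  have hΓ : 0 < Real.Gamma ν := Real.Gamma_pos_of_pos hν
  have h2 : (α * c) ^ (2 * ν) = (α * c) ^ ν * (α * c) ^ ν := by
    rw [← Real.rpow_add he]; ring_nf
  have h4 : (4 : ℝ) ^ ν = 2 ^ ν * 2 ^ ν := by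
    rw [← Real.mul_rpow (by norm_num) (by norm_num)]; norm_num
  have h2ν : (0 : ℝ) < 2 ^ ν := by positivity
  have heν : 0 < (α * c) ^ ν := by positivity
  rcases hy.eq_or_lt with rfl | hy
  · simp only [mul_zero, maternCov, if_true, ne_eq, OfNat.ofNat_ne_zero, not_false_eq_true,
      zero_pow, Real.exp_zero, mul_one]
    rw [integral_invGamma hν (by positivity)]
    have : (1 / ((α * c) ^ 2 / 4)) ^ ν = 4 ^ ν / (α * c) ^ (2 * ν) := by
      rw [one_div_div, Real.div_rpow (by norm_num) (by positivity), Real.rpow_mul he.le,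
        Real.rpow_two]
    rw [this, h2, h4]
    field_simp
  · have hcy : c * y ≠ 0 := by positivity
    rw [maternCov, if_neg hcy, ← mul_assoc α c y, besselK_eq_integral hν he hy]
    rw [Real.div_rpow he.le (by positivity), Real.mul_rpow he.le hy.le,
      Real.mul_rpow (by norm_num) hy.le, Real.rpow_sub_one (by norm_num), h2, h4]
    have hyν : 0 < y ^ ν := by positivity
    generalize (∫ v in Set.Ioi (0 : ℝ), v ^ (-ν - 1) * Real.exp (-((α * c) ^ 2 / 4) / v)
        * Real.exp (-v * y ^ 2)) = I
    field_simp

/-! ### Even differences of Gaussian kernels -/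

/-- The symmetric difference of order `2 m` of `φ` at `0`, up to the sign `(-1) ^ m`. -/
noncomputable def altSum (m : ℕ) (φ : ℝ → ℝ) : ℝ :=
  ∑ i ∈ Finset.range (m + 1), ∑ j ∈ Finset.range (m + 1),
    (-1) ^ (i + j) * (m.choose i : ℝ) * (m.choose j : ℝ) * φ ((i : ℝ) - (j : ℝ))

theorem neg_one_pow_sub_eq {m i : ℕ} (h : i ≤ m) : (-1 : ℝ) ^ (m - i) = (-1) ^ m * (-1) ^ i := by
  obtain ⟨k, rfl⟩ := Nat.exists_eq_add_of_le h
  rw [Nat.add_sub_cancel_left, pow_add, mul_right_comm, ← mul_pow]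
  simp

theorem altSum_eq_fwdDiff (m : ℕ) (φ : ℝ → ℝ) :
    altSum m φ = (-1) ^ m * (fwdDiff (1 : ℝ))^[2 * m] φ (-m) := by
  have h1 : ∀ y : ℝ, ∑ i ∈ Finset.range (m + 1), (-1) ^ i * (m.choose i : ℝ) * φ (i + y)
      = (-1) ^ m * (fwdDiff (1 : ℝ))^[m] φ y := by
    intro y
    rw [fwdDiff_iter_eq_sum_shift, Finset.mul_sum]
    refine Finset.sum_congr rfl fun i hi => ?_
    have hi' : i ≤ m := Nat.lt_succ_iff.mp (Finset.mem_range.mp hi)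
    rw [zsmul_eq_mul]
    push_cast
    rw [neg_one_pow_sub_eq hi', nsmul_eq_mul, mul_one, add_comm y]
    have : ((-1 : ℝ) ^ m) * (-1) ^ m = 1 := by rw [← mul_pow]; simp
    linear_combination (-(-1) ^ i * (m.choose i : ℝ) * φ (i + y)) * this
  have h2 : altSum m φ = ∑ j ∈ Finset.range (m + 1), (-1) ^ j * (m.choose j : ℝ) *
      ((-1) ^ m * (fwdDiff (1 : ℝ))^[m] φ (-j)) := by
    rw [altSum, Finset.sum_comm]
    refine Finset.sum_congr rfl fun j _ => ?_
    rw [← h1, Finset.mul_sum]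
    refine Finset.sum_congr rfl fun i _ => ?_
    rw [pow_add, sub_eq_add_neg]
    ring
  rw [h2, two_mul, Function.iterate_add_apply, fwdDiff_iter_eq_sum_shift, Finset.mul_sum,
    ← Finset.sum_range_reflect]
  refine Finset.sum_congr rfl fun i hi => ?_
  have hi' : i ≤ m := Nat.lt_succ_iff.mp (Finset.mem_range.mp hi)
  rw [zsmul_eq_mul]
  have h3 : m + 1 - 1 - i = m - i := by omega
  rw [h3, Nat.choose_symm hi', Nat.cast_sub hi', nsmul_eq_mul, mul_one, neg_sub]
  push_cast
  rw [show (i : ℝ) - m = -m + i by ring]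
  ring

theorem altSum_pow_eq_zero {m l : ℕ} (h : l < 2 * m) : altSum m (fun x => x ^ l) = 0 := by
  rw [altSum_eq_fwdDiff, fwdDiff_iter_pow_eq_zero_of_lt h]
  simp

/-- The mean value inequality, iterated: each unit difference is traded for one derivative and
lengthens the interval by one. -/
theorem abs_fwdDiff_iter_le {f : ℝ → ℝ} (hf : ContDiff ℝ (⊤ : ℕ∞) f) (n : ℕ) (x B : ℝ)
    (hB : ∀ y ∈ Set.Icc x (x + n), |iteratedDeriv n f y| ≤ B) :
    |(fwdDiff (1 : ℝ))^[n] f x| ≤ B := by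
  induction n generalizing f with
  | zero => simpa using hB x (by simp)
  | succ n ih =>
    rw [Function.iterate_succ_apply]
    have hshift : ContDiff ℝ (⊤ : ℕ∞) (fun y => f (y + 1)) := hf.comp (contDiff_id.add contDiff_const)
    refine ih (f := fwdDiff 1 f) (hshift.sub hf) fun y hy => ?_
    have h1 : iteratedDeriv n (fwdDiff 1 f) y = iteratedDeriv n f (y + 1) - iteratedDeriv n f y := by
      have : fwdDiff (1 : ℝ) f = (fun y => f (y + 1)) - f := rfl
      rw [this, iteratedDeriv_sub (hshift.contDiffAt.of_le (by exact_mod_cast le_top))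
        (hf.contDiffAt.of_le (by exact_mod_cast le_top)), iteratedDeriv_comp_add_const]
    have hd : Differentiable ℝ (iteratedDeriv n f) :=
      hf.differentiable_iteratedDeriv n (by exact_mod_cast WithTop.coe_lt_top n)
    have h2 := Convex.norm_image_sub_le_of_norm_deriv_le (f := iteratedDeriv n f)
      (s := Set.Icc y (y + 1)) (x := y) (y := y + 1) (C := B) (fun z _ => hd z)
      (fun z hz => by
        rw [← iteratedDeriv_succ]
        refine hB z ⟨hy.1.trans hz.1, ?_⟩
        push_cast
        linarith [hz.2, hy.2]) (convex_Icc _ _) (by simp) (by simp)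
    rw [h1]
    simpa using h2

theorem exists_abs_polynomial_mul_exp_le (p : Polynomial ℤ) :
    ∃ C : ℝ, ∀ y : ℝ, |Polynomial.aeval y p| * Real.exp (-(y ^ 2 / 4)) ≤ C := by
  -- Each monomial is bounded by `|y| ^ k ≤ k! exp |y|`, and `|y| - y² / 4 ≤ 1`.
  refine ⟨∑ k ∈ Finset.range (p.natDegree + 1), |(p.coeff k : ℝ)| * (k.factorial * Real.exp 1),
    fun y => ?_⟩
  have hmono : ∀ k : ℕ, |y| ^ k * Real.exp (-(y ^ 2 / 4)) ≤ k.factorial * Real.exp 1 := by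
    intro k
    have h1 : |y| ^ k ≤ k.factorial * Real.exp |y| := by
      have := Real.pow_div_factorial_le_exp |y| (abs_nonneg y) k
      rwa [div_le_iff₀ (by positivity), mul_comm] at this
    calc |y| ^ k * Real.exp (-(y ^ 2 / 4))
        ≤ k.factorial * Real.exp |y| * Real.exp (-(y ^ 2 / 4)) := by gcongr
      _ = k.factorial * Real.exp (|y| + -(y ^ 2 / 4)) := by rw [mul_assoc, ← Real.exp_add]
      _ ≤ k.factorial * Real.exp 1 := by
        gcongr
        nlinarith [sq_abs y, sq_nonneg (|y| - 2)]
  rw [Polynomial.aeval_eq_sum_range]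
  calc |∑ k ∈ Finset.range (p.natDegree + 1), p.coeff k • y ^ k| * Real.exp (-(y ^ 2 / 4))
      ≤ (∑ k ∈ Finset.range (p.natDegree + 1), |(p.coeff k : ℝ)| * |y| ^ k)
          * Real.exp (-(y ^ 2 / 4)) := by
        gcongr
        refine (Finset.abs_sum_le_sum_abs _ _).trans (Finset.sum_le_sum fun k _ => ?_)
        rw [zsmul_eq_mul, abs_mul, abs_pow]
    _ = ∑ k ∈ Finset.range (p.natDegree + 1),
          |(p.coeff k : ℝ)| * (|y| ^ k * Real.exp (-(y ^ 2 / 4))) := by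
        rw [Finset.sum_mul]
        exact Finset.sum_congr rfl fun k _ => by ring
    _ ≤ _ := Finset.sum_le_sum fun k _ =>
        mul_le_mul_of_nonneg_left (hmono k) (abs_nonneg _)

/-- Derivatives of the Gaussian are Hermite polynomials times the Gaussian; half of the exponent
absorbs the polynomial and the other half is kept as decay. -/
theorem exists_abs_iteratedDeriv_gaussian_le (n : ℕ) :
    ∃ C : ℝ, 0 ≤ C ∧ ∀ y : ℝ, |iteratedDeriv n (fun x : ℝ => Real.exp (-(x ^ 2 / 2))) y|
      ≤ C * Real.exp (-(y ^ 2 / 4)) := by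
  obtain ⟨C, hC⟩ := exists_abs_polynomial_mul_exp_le (Polynomial.hermite n)
  refine ⟨C, le_trans (by positivity) (hC 0), fun y => ?_⟩
  rw [iteratedDeriv_eq_iterate, Polynomial.deriv_gaussian_eq_hermite_mul_gaussian, abs_mul, abs_mul,
    abs_pow, abs_neg, abs_one, one_pow, one_mul, Real.abs_exp]
  have : Real.exp (-(y ^ 2 / 2)) = Real.exp (-(y ^ 2 / 4)) * Real.exp (-(y ^ 2 / 4)) := by
    rw [← Real.exp_add]; ring_nf
  rw [this, ← mul_assoc]
  gcongr
  exact hC y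

section Line

variable {E : Type*} [NormedAddCommGroup E] [InnerProductSpace ℝ E]

/-- Symmetric differences of a Gaussian kernel along a line decay like the kernel away from its
centre, with the power of the inverse squared bandwidth given by the order. -/
theorem exists_abs_altSum_gaussian_le (m : ℕ) :
    ∃ C : ℝ, 0 ≤ C ∧ ∀ (w e : E) (v L : ℝ), 0 < v → ‖e‖ = 1 →
      (∀ s : ℝ, |s| ≤ m → L ≤ ‖w + s • e‖ ^ 2) →
      |altSum m (fun s => Real.exp (-v * ‖w + s • e‖ ^ 2))|
        ≤ C * v ^ m * Real.exp (-v * (L / 2)) := by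
  obtain ⟨C, hC0, hC⟩ := exists_abs_iteratedDeriv_gaussian_le (2 * m)
  refine ⟨C * 2 ^ m, by positivity, fun w e v L hv he hL => ?_⟩
  set s₀ : ℝ := inner ℝ w e
  -- The squared distance from the origin to the line `w + ℝ e`. By Pythagoras the kernel along the
  -- line is a one-dimensional Gaussian centred at `-s₀`, times `exp (-v δ)`.
  set δ : ℝ := ‖w‖ ^ 2 - s₀ ^ 2
  set η : ℝ := Real.sqrt (2 * v)
  have hη : η ^ 2 = 2 * v := Real.sq_sqrt (by positivity)
  have hδ : 0 ≤ δ := by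
    have h1 := abs_real_inner_le_norm w e
    rw [he, mul_one] at h1
    have := sq_le_sq' (by linarith [neg_abs_le s₀, norm_nonneg w]) (le_trans (le_abs_self s₀) h1)
    simp only [δ]
    nlinarith [sq_abs s₀, abs_nonneg s₀]
  have hnorm : ∀ s : ℝ, ‖w + s • e‖ ^ 2 = (s + s₀) ^ 2 + δ := by
    intro s
    rw [norm_add_sq_real, inner_smul_right, norm_smul, he, mul_one, Real.norm_eq_abs, sq_abs]
    simp only [δ, s₀]
    ring
  set γ : ℝ → ℝ := fun x => Real.exp (-(x ^ 2 / 2)) with hγ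
  have hγc : ContDiff ℝ (⊤ : ℕ∞) γ := by simp only [hγ]; fun_prop
  have hf : (fun s : ℝ => Real.exp (-v * ‖w + s • e‖ ^ 2))
      = fun s => Real.exp (-v * δ) * (fun s => γ (η * s)) (s + s₀) := by
    funext s
    simp only [hγ]
    rw [hnorm, ← Real.exp_add]
    congr 1
    rw [mul_pow, hη]
    ring
  have hder : ∀ s : ℝ, iteratedDeriv (2 * m) (fun s : ℝ => Real.exp (-v * ‖w + s • e‖ ^ 2)) s
      = Real.exp (-v * δ) * (η ^ (2 * m) * iteratedDeriv (2 * m) γ (η * (s + s₀))) := by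
    intro s
    rw [hf, iteratedDeriv_const_mul_field,
      iteratedDeriv_comp_add_const (2 * m) (fun s => γ (η * s)) s₀]
    simp only
    rw [iteratedDeriv_comp_const_mul (contDiff_infty.1 hγc (2 * m)) η]
  rw [altSum_eq_fwdDiff, abs_mul, abs_pow, abs_neg, abs_one, one_pow, one_mul]
  refine abs_fwdDiff_iter_le ?_ _ _ _ fun s hs => ?_
  · have : (fun s : ℝ => Real.exp (-v * ‖w + s • e‖ ^ 2))
      = fun s => Real.exp (-v * ((s + s₀) ^ 2 + δ)) := by funext s; rw [hnorm]
    rw [this]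
    fun_prop
  · rw [hder, abs_mul, Real.abs_exp, abs_mul, pow_mul, hη, abs_of_nonneg (by positivity)]
    have hsm : |s| ≤ m := by
      rw [abs_le]
      have h2 := hs.2
      push_cast at h2
      exact ⟨hs.1, by linarith⟩
    have hlow : L ≤ (s + s₀) ^ 2 + δ := (hL s hsm).trans_eq (hnorm s)
    calc Real.exp (-v * δ) * ((2 * v) ^ m * |iteratedDeriv (2 * m) γ (η * (s + s₀))|)
        ≤ Real.exp (-v * δ) * ((2 * v) ^ m * (C * Real.exp (-((η * (s + s₀)) ^ 2 / 4)))) := by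
          gcongr
          exact hC _
      _ = C * 2 ^ m * v ^ m * Real.exp (-v * δ + -((η * (s + s₀)) ^ 2 / 4)) := by
          rw [Real.exp_add, mul_pow]; ring
      _ ≤ C * 2 ^ m * v ^ m * Real.exp (-v * (L / 2)) := by
          gcongr
          rw [mul_pow, hη]
          nlinarith [mul_nonneg hv.le hδ, mul_le_mul_of_nonneg_left hlow hv.le]

end Line

theorem abs_altSum_le {m : ℕ} {φ : ℝ → ℝ} {B : ℝ} (hB : ∀ s, |φ s| ≤ B) :
    |altSum m φ| ≤ 4 ^ m * B := by
  have h4 : (∑ i ∈ Finset.range (m + 1), (m.choose i : ℝ)) = 2 ^ m := by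
    exact_mod_cast Nat.sum_range_choose m
  calc |altSum m φ| ≤ ∑ i ∈ Finset.range (m + 1), ∑ j ∈ Finset.range (m + 1),
        (m.choose i : ℝ) * (m.choose j : ℝ) * B := by
        refine (Finset.abs_sum_le_sum_abs _ _).trans (Finset.sum_le_sum fun i _ => ?_)
        refine (Finset.abs_sum_le_sum_abs _ _).trans (Finset.sum_le_sum fun j _ => ?_)
        rw [abs_mul, abs_mul, abs_mul, abs_pow, abs_neg, abs_one, one_pow, one_mul,
          Nat.abs_cast, Nat.abs_cast]
        gcongr
        exact hB _
    _ = 4 ^ m * B := by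
        simp_rw [← Finset.sum_mul, ← Finset.mul_sum, h4, ← Finset.sum_mul, h4]
        rw [← mul_pow]
        norm_num

/-- Positive definiteness of the Gaussian kernel: after the diagonal factors are split off, the
power series of `exp (2 v i j)` has in each degree a nonnegative multiple of a square. -/
theorem altSum_gaussian_nonneg (m : ℕ) {v : ℝ} (hv : 0 ≤ v) :
    0 ≤ altSum m (fun x => Real.exp (-v * x ^ 2)) := by
  set a : ℕ → ℝ := fun i => (-1) ^ i * (m.choose i : ℝ) * Real.exp (-v * (i : ℝ) ^ 2) with ha
  have h1 : altSum m (fun x => Real.exp (-v * x ^ 2)) = ∑ i ∈ Finset.range (m + 1),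
      ∑ j ∈ Finset.range (m + 1), a i * a j * Real.exp (2 * v * (i * j)) := by
    refine Finset.sum_congr rfl fun i _ => Finset.sum_congr rfl fun j _ => ?_
    have : Real.exp (-v * ((i : ℝ) - j) ^ 2) = Real.exp (-v * (i : ℝ) ^ 2)
        * Real.exp (-v * (j : ℝ) ^ 2) * Real.exp (2 * v * (i * j)) := by
      rw [← Real.exp_add, ← Real.exp_add]; ring_nf
    simp only [this, ha, pow_add]
    ring
  have hexp : ∀ x : ℝ, HasSum (fun k : ℕ => x ^ k / k.factorial) (Real.exp x) := fun x => by
    rw [Real.exp_eq_exp_ℝ]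
    exact NormedSpace.expSeries_div_hasSum_exp x
  have h2 := hasSum_sum fun i (_ : i ∈ Finset.range (m + 1)) =>
    hasSum_sum fun j (_ : j ∈ Finset.range (m + 1)) =>
      (hexp (2 * v * (i * j))).mul_left (a i * a j)
  rw [h1]
  refine h2.nonneg fun k => ?_
  have h3 : ∑ i ∈ Finset.range (m + 1), ∑ j ∈ Finset.range (m + 1),
      a i * a j * ((2 * v * (i * j)) ^ k / k.factorial)
      = (2 * v) ^ k / k.factorial * (∑ i ∈ Finset.range (m + 1), a i * (i : ℝ) ^ k) ^ 2 := by
    rw [sq, Finset.sum_mul_sum, Finset.mul_sum]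
    refine Finset.sum_congr rfl fun i _ => ?_
    rw [Finset.mul_sum]
    exact Finset.sum_congr rfl fun j _ => by rw [mul_pow, mul_pow]; ring
  rw [h3]
  positivity

/-- As `v → ∞` only the terms `i = j` survive, and they add up to a sum of squared binomial
coefficients. -/
theorem eventually_altSum_gaussian_pos (m : ℕ) :
    ∀ᶠ v : ℝ in atTop, 0 < altSum m (fun x => Real.exp (-v * x ^ 2)) := by
  have hlim : Tendsto (fun v : ℝ => altSum m (fun x => Real.exp (-v * x ^ 2))) atTop
      (𝓝 (∑ i ∈ Finset.range (m + 1), ∑ j ∈ Finset.range (m + 1),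
        (-1) ^ (i + j) * (m.choose i : ℝ) * (m.choose j : ℝ) * if i = j then 1 else 0)) := by
    refine tendsto_finsetSum _ fun i _ => tendsto_finsetSum _ fun j _ => Tendsto.const_mul _ ?_
    split_ifs with hij
    · simp [hij]
    · refine Real.tendsto_exp_atBot.comp ?_
      have : (0 : ℝ) < ((i : ℝ) - j) ^ 2 := by
        have : (i : ℝ) - j ≠ 0 := sub_ne_zero.2 (by exact_mod_cast hij)
        positivity
      exact tendsto_neg_atTop_atBot.atBot_mul_const this
  refine hlim.eventually_const_lt ?_
  simp only [mul_ite, mul_one, mul_zero, Finset.sum_ite_eq]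
  refine Finset.sum_pos (fun i hi => ?_) ⟨0, by simp⟩
  rw [if_pos hi, ← two_mul, pow_mul]
  have := Nat.choose_pos (Nat.lt_succ_iff.mp (Finset.mem_range.mp hi))
  simp only [even_two, Even.neg_pow, one_pow, one_mul]
  positivity

/-! ### Mellin transforms of exponential sums -/

theorem integrableOn_rpow_mul_of_bounds {f : ℝ → ℝ} {s a b A B : ℝ}
    (hf : AEStronglyMeasurable f (volume.restrict (Set.Ioi 0))) (ha : 0 < s + a) (hb : s + b < 0)
    (h0 : ∀ v, 0 < v → |f v| ≤ A * v ^ a) (h1 : ∀ v, 0 < v → |f v| ≤ B * v ^ b) :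
    IntegrableOn (fun v => v ^ (s - 1) * f v) (Set.Ioi 0) := by
  have hm : AEStronglyMeasurable (fun v => v ^ (s - 1) * f v) (volume.restrict (Set.Ioi 0)) :=
    AEStronglyMeasurable.mul (by fun_prop) hf
  rw [← Set.Ioc_union_Ioi_eq_Ioi zero_le_one]
  refine IntegrableOn.union ?_ ?_
  · have hi : IntegrableOn (fun v : ℝ => A * v ^ (s + a - 1)) (Set.Ioc 0 1) := by
      rw [← intervalIntegrable_iff_integrableOn_Ioc_of_le zero_le_one]
      exact (intervalIntegral.intervalIntegrable_rpow' (by linarith)).const_mul A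
    refine hi.mono' (hm.mono_set Set.Ioc_subset_Ioi_self) ?_
    refine (ae_restrict_iff' measurableSet_Ioc).2 (Eventually.of_forall fun v hv => ?_)
    have hv0 := hv.1
    rw [norm_mul, Real.norm_of_nonneg (by positivity), Real.norm_eq_abs]
    calc v ^ (s - 1) * |f v| ≤ v ^ (s - 1) * (A * v ^ a) := by gcongr; exact h0 v hv0
      _ = A * v ^ (s + a - 1) := by
        rw [show s + a - 1 = (s - 1) + a by ring, Real.rpow_add hv0]; ring
  · have hi : IntegrableOn (fun v : ℝ => B * v ^ (s + b - 1)) (Set.Ioi 1) :=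
      (integrableOn_Ioi_rpow_of_lt (by linarith) one_pos).const_mul B
    refine hi.mono' (hm.mono_set (Set.Ioi_subset_Ioi zero_le_one)) ?_
    refine (ae_restrict_iff' measurableSet_Ioi).2 (Eventually.of_forall fun v (hv : 1 < v) => ?_)
    have hv0 : 0 < v := by linarith
    rw [norm_mul, Real.norm_of_nonneg (by positivity), Real.norm_eq_abs]
    calc v ^ (s - 1) * |f v| ≤ v ^ (s - 1) * (B * v ^ b) := by gcongr; exact h1 v hv0
      _ = B * v ^ (s + b - 1) := by
        rw [show s + b - 1 = (s - 1) + b by ring, Real.rpow_add hv0]; ring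

section ExpSum

variable {ι : Type*} (S : Finset ι) (c x : ι → ℝ)

/-- The exponential sum `∑ c_k exp (- v x_k)`. -/
noncomputable def expSum (v : ℝ) : ℝ := ∑ k ∈ S, c k * Real.exp (-v * x k)

theorem hasDerivAt_expSum (v : ℝ) :
    HasDerivAt (expSum S c x) (-expSum S (fun k => c k * x k) x v) v := by
  have h : HasDerivAt (fun v => ∑ k ∈ S, c k * Real.exp (-v * x k))
      (∑ k ∈ S, c k * (Real.exp (-v * x k) * (-1 * x k))) v := by
    refine HasDerivAt.fun_sum fun k _ => ?_
    exact ((((hasDerivAt_id v).neg).mul_const (x k)).exp).const_mul (c k)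
  have h' : -expSum S (fun k => c k * x k) x v
      = ∑ k ∈ S, c k * (Real.exp (-v * x k) * (-1 * x k)) := by
    rw [expSum, ← Finset.sum_neg_distrib]
    exact Finset.sum_congr rfl fun k _ => by ring
  rw [h']
  exact h

@[fun_prop]
theorem continuous_expSum : Continuous (expSum S c x) := by
  unfold expSum; fun_prop

variable {S c x}

/-- Differentiation shifts the moments by one, so the derivative has one vanishing moment fewer;
integrating its bound from `0` gains one power of `v`. -/
theorem exists_abs_expSum_le (hx : ∀ k ∈ S, 0 ≤ x k) (n : ℕ)
    (hmom : ∀ l < n, ∑ k ∈ S, c k * x k ^ l = 0) :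
    ∃ C : ℝ, 0 ≤ C ∧ ∀ v, 0 ≤ v → |expSum S c x v| ≤ C * v ^ n := by
  induction n generalizing c with
  | zero =>
    refine ⟨∑ k ∈ S, |c k|, by positivity, fun v hv => ?_⟩
    rw [pow_zero, mul_one]
    refine (Finset.abs_sum_le_sum_abs _ _).trans (Finset.sum_le_sum fun k hk => ?_)
    rw [abs_mul, Real.abs_exp]
    refine mul_le_of_le_one_right (abs_nonneg _) (Real.exp_le_one_iff.2 ?_)
    nlinarith [mul_nonneg hv (hx k hk)]
  | succ n ih =>
    obtain ⟨C, hC0, hC⟩ := ih (c := fun k => c k * x k) fun l hl => by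
      rw [← hmom (l + 1) (by omega)]
      exact Finset.sum_congr rfl fun k _ => by ring
    refine ⟨C, hC0, fun v hv => ?_⟩
    have h0 : expSum S c x 0 = 0 := by
      simpa [expSum] using hmom 0 (by omega)
    have h := Convex.norm_image_sub_le_of_norm_hasDerivWithin_le (f := expSum S c x)
      (s := Set.Icc 0 v) (x := 0) (y := v) (C := C * v ^ n)
      (fun z _ => (hasDerivAt_expSum S c x z).hasDerivWithinAt)
      (fun z hz => by
        rw [norm_neg, Real.norm_eq_abs]
        refine (hC z hz.1).trans ?_
        have := hz.1
        have := hz.2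
        gcongr) (convex_Icc _ _) (by simpa using hv) (by simpa using hv)
    rw [h0, sub_zero, sub_zero, Real.norm_eq_abs, Real.norm_of_nonneg hv] at h
    rw [pow_succ, ← mul_assoc]
    exact h

theorem exists_abs_expSum_le_inv (hx : ∀ k ∈ S, 0 ≤ x k) (hc : ∀ k ∈ S, x k = 0 → c k = 0) :
    ∃ C : ℝ, ∀ v, 0 < v → |expSum S c x v| ≤ C * v ^ (-1 : ℝ) := by
  refine ⟨∑ k ∈ S, |c k| * (x k)⁻¹, fun v hv => ?_⟩
  rw [Finset.sum_mul]
  refine (Finset.abs_sum_le_sum_abs _ _).trans (Finset.sum_le_sum fun k hk => ?_)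
  rcases (hx k hk).eq_or_lt with h0 | h0
  · simp [hc k hk h0.symm]
  · rw [abs_mul, Real.abs_exp, mul_assoc]
    gcongr
    rw [Real.rpow_neg_one, ← mul_inv, neg_mul, Real.exp_neg, mul_comm]
    gcongr
    linarith [Real.add_one_le_exp (x k * v)]

theorem integrableOn_rpow_mul_expSum (hx : ∀ k ∈ S, 0 ≤ x k) {n : ℕ}
    (hmom : ∀ l < n, ∑ k ∈ S, c k * x k ^ l = 0) {s : ℝ} (hs : 0 < s + n) (hs0 : s < 0) :
    IntegrableOn (fun v => v ^ (s - 1) * expSum S c x v) (Set.Ioi 0) := by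
  obtain ⟨A, -, hA⟩ := exists_abs_expSum_le hx n hmom
  obtain ⟨B, -, hB⟩ := exists_abs_expSum_le (c := c) hx 0 (by simp)
  refine integrableOn_rpow_mul_of_bounds (a := n) (b := 0) (A := A) (B := B)
    (continuous_expSum S c x).aestronglyMeasurable hs (by linarith) (fun v hv => ?_)
    (fun v hv => ?_)
  · rw [Real.rpow_natCast]; exact hA v hv.le
  · simpa using hB v hv.le

/-- Integration by parts. The boundary term vanishes at `0` because the sum is `O(v ^ (n + 1))`, and
at infinity because the sum is bounded and `s < 0`. -/
theorem integral_rpow_mul_expSum_eq (hx : ∀ k ∈ S, 0 ≤ x k) {n : ℕ}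
    (hmom : ∀ l < n + 1, ∑ k ∈ S, c k * x k ^ l = 0) {s : ℝ} (hs : 0 < s + (n + 1 : ℕ))
    (hs0 : s < 0) :
    ∫ v in Set.Ioi (0 : ℝ), v ^ (s - 1) * expSum S c x v
      = s⁻¹ * ∫ v in Set.Ioi (0 : ℝ), v ^ s * expSum S (fun k => c k * x k) x v := by
  obtain ⟨A, hA0, hA⟩ := exists_abs_expSum_le hx (n + 1) hmom
  obtain ⟨B, hB0, hB⟩ := exists_abs_expSum_le (c := c) hx 0 (by simp)
  obtain ⟨A', hA0', hA'⟩ := exists_abs_expSum_le (c := fun k => c k * x k) hx n fun l hl => by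
    rw [← hmom (l + 1) (by omega)]
    exact Finset.sum_congr rfl fun k _ => by ring
  obtain ⟨B', hB'⟩ := exists_abs_expSum_le_inv (c := fun k => c k * x k) hx
    fun k _ h => by simp [h]
  have hi := integrableOn_rpow_mul_expSum hx hmom hs hs0
  have hi' : IntegrableOn (fun v => v ^ s * expSum S (fun k => c k * x k) x v) (Set.Ioi 0) := by
    have := integrableOn_rpow_mul_of_bounds (s := s + 1) (a := n) (b := -1) (A := A') (B := B')
      (continuous_expSum S (fun k => c k * x k) x).aestronglyMeasurable
      (by push_cast at hs; linarith) (by linarith)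
      (fun v hv => by rw [Real.rpow_natCast]; exact hA' v hv.le) hB'
    simpa using this
  have hderiv : ∀ v ∈ Set.Ioi (0 : ℝ), HasDerivAt (fun v : ℝ => s⁻¹ * v ^ s) (v ^ (s - 1)) v := by
    intro v hv
    have := (Real.hasDerivAt_rpow_const (p := s) (Or.inl (ne_of_gt hv))).const_mul s⁻¹
    rwa [← mul_assoc, inv_mul_cancel₀ hs0.ne, one_mul] at this
  have hlim : ∀ {l : Filter ℝ} {K r : ℝ}, (∀ᶠ v in l, 0 < v) → Tendsto (fun v : ℝ => v ^ r) l (𝓝 0) →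
      (∀ v, 0 < v → |expSum S c x v| ≤ K * v ^ (r - s)) →
      Tendsto (expSum S c x * fun v : ℝ => s⁻¹ * v ^ s) l (𝓝 0) := by
    intro l K r hl hr hK
    have h2 := hr.const_mul (|s⁻¹| * K)
    rw [mul_zero] at h2
    refine squeeze_zero_norm' (hl.mono fun v hv => ?_) h2
    rw [Pi.mul_apply, norm_mul, norm_mul, Real.norm_eq_abs, Real.norm_eq_abs,
      Real.norm_of_nonneg (by positivity : 0 ≤ v ^ s)]
    calc |expSum S c x v| * (|s⁻¹| * v ^ s) ≤ (K * v ^ (r - s)) * (|s⁻¹| * v ^ s) := by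
          gcongr; exact hK v hv
      _ = |s⁻¹| * K * v ^ r := by
          rw [show v ^ r = v ^ (r - s) * v ^ s by rw [← Real.rpow_add hv]; ring_nf]; ring
  have key := integral_Ioi_mul_deriv_eq_deriv_mul (a := 0) (a' := 0) (b' := 0)
    (u := expSum S c x) (u' := fun v => -expSum S (fun k => c k * x k) x v)
    (v := fun v : ℝ => s⁻¹ * v ^ s) (v' := fun v => v ^ (s - 1))
    (fun v _ => hasDerivAt_expSum S c x v) hderiv
    (by refine hi.congr_fun (fun v _ => ?_) measurableSet_Ioi
        simp [mul_comm])
    (by refine IntegrableOn.congr_fun (hi'.const_mul (-s⁻¹)) (fun v _ => ?_) measurableSet_Ioi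
        simp only [Pi.mul_apply]; ring)
    (by
      refine hlim (K := A) (r := s + (n + 1 : ℕ)) self_mem_nhdsWithin ?_ fun v hv => ?_
      · have : Tendsto (fun v : ℝ => v ^ (s + (n + 1 : ℕ))) (𝓝 0) (𝓝 (0 ^ (s + (n + 1 : ℕ)))) :=
          (Real.continuous_rpow_const hs.le).tendsto 0
        rw [Real.zero_rpow hs.ne'] at this
        exact this.mono_left nhdsWithin_le_nhds
      · rw [add_sub_cancel_left, Real.rpow_natCast]; exact hA v hv.le)
    (by
      refine hlim (K := B) (r := s) (eventually_gt_atTop 0) ?_ fun v hv => ?_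
      · have := tendsto_rpow_neg_atTop (y := -s) (by linarith)
        rwa [neg_neg] at this
      · simpa using hB v hv.le)
  calc _ = ∫ v in Set.Ioi (0 : ℝ), expSum S c x v * v ^ (s - 1) := by simp_rw [mul_comm]
    _ = _ := by
      rw [key, sub_zero, zero_sub, ← integral_neg, ← integral_const_mul]
      refine integral_congr_ae (Eventually.of_forall fun v => ?_)
      simp only
      ring

/-- The Gamma integral continued to the strip `-n < s < -n + 1` by `n` integrations by parts. Each
one multiplies the weights by `x k`, which removes the exponents `x k = 0`; only for `n = 0` must
they be excluded by hypothesis. -/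
theorem integral_rpow_mul_expSum_of_ne (hx : ∀ k ∈ S, 0 ≤ x k) (n : ℕ)
    (hmom : ∀ l < n, ∑ k ∈ S, c k * x k ^ l = 0)
    (hc : n = 0 → ∀ k ∈ S, x k = 0 → c k = 0) {s : ℝ} (hs : -(n : ℝ) < s) (hs1 : s < -n + 1) :
    ∫ v in Set.Ioi (0 : ℝ), v ^ (s - 1) * expSum S c x v
      = Real.Gamma s * ∑ k ∈ S, c k * x k ^ (-s) := by
  induction n generalizing c s with
  | zero =>
    have hs' : 0 < s := by simpa using hs
    have hterm : ∀ k ∈ S, IntegrableOn (fun v : ℝ => v ^ (s - 1) * (c k * Real.exp (-v * x k)))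
        (Set.Ioi 0) ∧ ∫ v in Set.Ioi (0 : ℝ), v ^ (s - 1) * (c k * Real.exp (-v * x k))
          = Real.Gamma s * (c k * x k ^ (-s)) := by
      intro k hk
      rcases (hx k hk).eq_or_lt with h0 | h0
      · simp [hc rfl k hk h0.symm]
      · have h1 := integrableOn_rpow_mul_exp_neg_mul_rpow (s := s - 1) (by linarith) one_pos h0
        have h2 := Real.integral_rpow_mul_exp_neg_mul_Ioi hs' h0
        have he : ∀ v : ℝ, v ^ (s - 1) * (c k * Real.exp (-v * x k))
            = c k * (v ^ (s - 1) * Real.exp (-(x k * v))) := fun v => by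
          rw [neg_mul, mul_comm v]; ring
        simp only [he]
        simp only [Real.rpow_one, neg_mul] at h1
        refine ⟨h1.const_mul _, ?_⟩
        rw [integral_const_mul, h2, one_div, Real.inv_rpow h0.le, Real.rpow_neg h0.le]
        ring
    simp only [expSum, Finset.mul_sum]
    rw [integral_finsetSum _ fun k hk => (hterm k hk).1]
    exact Finset.sum_congr rfl fun k hk => (hterm k hk).2
  | succ n ih =>
    have hs0 : s < 0 := by
      push_cast at hs1
      have : (0 : ℝ) ≤ n := n.cast_nonneg
      linarith
    push_cast at hs hs1
    rw [integral_rpow_mul_expSum_eq hx hmom (by push_cast; linarith) hs0]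
    have h := ih (c := fun k => c k * x k) (s := s + 1)
      (fun l hl => by
        rw [← hmom (l + 1) (by omega)]
        exact Finset.sum_congr rfl fun k _ => by ring)
      (fun _ k _ hk => by simp [hk]) (by linarith) (by linarith)
    rw [add_sub_cancel_right] at h
    rw [h, Real.Gamma_add_one hs0.ne, ← mul_assoc, ← mul_assoc, inv_mul_cancel₀ hs0.ne, one_mul]
    congr 1
    refine Finset.sum_congr rfl fun k hk => ?_
    rcases (hx k hk).eq_or_lt with h0 | h0
    · rw [← h0, Real.zero_rpow (x := -s) (by linarith)]; simp
    · rw [show -s = -(s + 1) + 1 by ring, Real.rpow_add_one h0.ne']; ring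

/-- At the pole `s = 0` of Gamma, the vanishing total weight allows `exp (-v)` to be subtracted from
every term, and Frullani's integral gives the logarithms. -/
theorem integral_inv_mul_expSum (hx : ∀ k ∈ S, 0 ≤ x k) (hmom : ∑ k ∈ S, c k = 0)
    (hc : ∀ k ∈ S, x k = 0 → c k = 0) :
    ∫ v in Set.Ioi (0 : ℝ), v ^ (-1 : ℝ) * expSum S c x v = -∑ k ∈ S, c k * Real.log (x k) := by
  have hterm : ∀ k ∈ S,
      IntegrableOn (fun v : ℝ => c k * (v⁻¹ • (Real.exp (-(x k * v)) - Real.exp (-(1 * v)))))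
        (Set.Ioi 0) ∧
      ∫ v in Set.Ioi (0 : ℝ), c k * (v⁻¹ • (Real.exp (-(x k * v)) - Real.exp (-(1 * v))))
          = -(c k * Real.log (x k)) := by
    intro k hk
    rcases (hx k hk).eq_or_lt with h0 | h0
    · simp [hc k hk h0.symm]
    · have hint : IntegrableOn (fun v : ℝ => v⁻¹ • (Real.exp (-(x k * v)) - Real.exp (-(1 * v))))
          (Set.Ioi 0) := by
        let c' : Fin 2 → ℝ := ![1, -1]
        let x' : Fin 2 → ℝ := ![x k, 1]
        have hx' : ∀ i ∈ (Finset.univ : Finset (Fin 2)), 0 ≤ x' i := by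
          intro i _; fin_cases i <;> simp [x', h0.le]
        have he : ∀ v, expSum Finset.univ c' x' v
            = Real.exp (-(x k * v)) - Real.exp (-(1 * v)) := by
          intro v; simp [expSum, c', x', mul_comm v]; ring
        obtain ⟨A, -, hA⟩ := exists_abs_expSum_le (c := c') hx' 1 (by
          intro l hl
          obtain rfl : l = 0 := by omega
          simp [c'])
        obtain ⟨B, hB⟩ := exists_abs_expSum_le_inv (c := c') hx' (by
          intro i _; fin_cases i <;> simp [x', h0.ne'])
        have := integrableOn_rpow_mul_of_bounds (s := 0) (a := 1) (b := -1) (A := A) (B := B)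
          (continuous_expSum Finset.univ c' x').aestronglyMeasurable (by norm_num) (by norm_num)
          (fun v hv => by simpa using hA v hv.le) hB
        refine this.congr_fun (fun v _ => ?_) measurableSet_Ioi
        simp only [he, zero_sub, Real.rpow_neg_one, smul_eq_mul]
      refine ⟨hint.const_mul _, ?_⟩
      have hcont : Continuous fun v : ℝ => Real.exp (-v) := by fun_prop
      have hL : Tendsto (fun v : ℝ => Real.exp (-v)) (𝓝[>] 0) (𝓝 1) := by
        have := hcont.tendsto 0
        simp only [neg_zero, Real.exp_zero] at this
        exact this.mono_left nhdsWithin_le_nhds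
      have hF := Frullani.integral_Ioi_eq (f := fun v : ℝ => Real.exp (-v)) (L := 1) (R := 0)
        (hcont.locallyIntegrable.locallyIntegrableOn _) h0 one_pos hL
        (Real.tendsto_exp_atBot.comp tendsto_neg_atTop_atBot) hint
      rw [integral_const_mul, hF, one_div, Real.log_inv, sub_zero, smul_eq_mul, mul_one]
      ring
  rw [← Finset.sum_neg_distrib, ← Finset.sum_congr rfl fun k hk => (hterm k hk).2,
    ← integral_finsetSum _ fun k hk => (hterm k hk).1]
  refine integral_congr_ae (Eventually.of_forall fun v => ?_)
  simp only [smul_eq_mul, mul_sub, Finset.sum_sub_distrib, ← Finset.sum_mul, hmom, zero_mul,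
    sub_zero, expSum, Real.rpow_neg_one, Finset.mul_sum]
  exact Finset.sum_congr rfl fun k _ => by rw [neg_mul, mul_comm v]; ring

/-- At `s = -n` the `n` integrations by parts end at the Frullani case, and their factors `s⁻¹`
multiply to `(-1) ^ n / n!`. -/
theorem integral_rpow_mul_expSum_nat (hx : ∀ k ∈ S, 0 ≤ x k) (n : ℕ)
    (hmom : ∀ l < n + 1, ∑ k ∈ S, c k * x k ^ l = 0)
    (hc : n = 0 → ∀ k ∈ S, x k = 0 → c k = 0) :
    ∫ v in Set.Ioi (0 : ℝ), v ^ (-(n : ℝ) - 1) * expSum S c x v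
      = (-1) ^ (n + 1) / n.factorial * ∑ k ∈ S, c k * x k ^ n * Real.log (x k) := by
  induction n generalizing c with
  | zero =>
    have := integral_inv_mul_expSum hx (by simpa using hmom 0 (by omega)) (hc rfl)
    simpa using this
  | succ n ih =>
    rw [integral_rpow_mul_expSum_eq hx (n := n + 1) hmom (by push_cast; linarith)
      (by push_cast; linarith [(n.cast_nonneg : (0 : ℝ) ≤ n)])]
    have h := ih (c := fun k => c k * x k)
      (fun l hl => by
        rw [← hmom (l + 1) (by omega)]
        exact Finset.sum_congr rfl fun k _ => by ring)
      (fun _ k _ hk => by simp [hk])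
    rw [show (-((n + 1 : ℕ) : ℝ)) = -(n : ℝ) - 1 by push_cast; ring, h, Nat.factorial_succ]
    have : (n.factorial : ℝ) ≠ 0 := by positivity
    have h3 : ∀ k, c k * x k * x k ^ n * Real.log (x k)
        = c k * x k ^ (n + 1) * Real.log (x k) := fun k => by ring
    have h4 : (-(n : ℝ) - 1) ≠ 0 := by linarith [(n.cast_nonneg : (0 : ℝ) ≤ n)]
    have h5 : ((n : ℝ) + 1) ≠ 0 := by positivity
    simp only [h3]
    rw [← mul_assoc]
    congr 1
    push_cast
    rw [show (-(n : ℝ) - 1) = -((n : ℝ) + 1) by ring]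
    field_simp
    ring

end ExpSum

/-! ### Irregular sums as Mellin transforms, and their positivity -/

section AltSum

variable {m : ℕ}

theorem altSum_eq_sum_product (m : ℕ) (φ : ℝ → ℝ) :
    altSum m φ = ∑ k ∈ Finset.range (m + 1) ×ˢ Finset.range (m + 1),
      ((-1) ^ (k.1 + k.2) * (m.choose k.1 : ℝ) * (m.choose k.2 : ℝ)) * φ ((k.1 : ℝ) - k.2) := by
  rw [altSum, Finset.sum_product]

theorem altSum_gaussian_eq_expSum (m : ℕ) (v : ℝ) :
    altSum m (fun x => Real.exp (-v * x ^ 2))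
      = expSum (Finset.range (m + 1) ×ˢ Finset.range (m + 1))
        (fun k => (-1) ^ (k.1 + k.2) * (m.choose k.1 : ℝ) * (m.choose k.2 : ℝ))
        (fun k => ((k.1 : ℝ) - k.2) ^ 2) v :=
  altSum_eq_sum_product m _

theorem sum_product_sq_pow_eq_zero {l : ℕ} (h : l < m) :
    ∑ k ∈ Finset.range (m + 1) ×ˢ Finset.range (m + 1),
      ((-1) ^ (k.1 + k.2) * (m.choose k.1 : ℝ) * (m.choose k.2 : ℝ))
        * (((k.1 : ℝ) - k.2) ^ 2) ^ l = 0 := by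
  rw [← altSum_pow_eq_zero (show 2 * l < 2 * m by omega), altSum_eq_sum_product]
  simp only [pow_mul]

theorem continuous_altSum_gaussian (m : ℕ) :
    Continuous fun v : ℝ => altSum m (fun x => Real.exp (-v * x ^ 2)) := by
  simp only [altSum_gaussian_eq_expSum]
  exact continuous_expSum _ _ _

theorem integrableOn_rpow_mul_altSum {ν : ℝ} (hν : 0 < ν) (hm : ν < m) :
    IntegrableOn (fun v : ℝ => v ^ (-ν - 1) * altSum m (fun x => Real.exp (-v * x ^ 2)))
      (Set.Ioi 0) := by
  simp only [altSum_gaussian_eq_expSum]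
  exact integrableOn_rpow_mul_expSum (fun k _ => by positivity) (n := m)
    (fun l hl => sum_product_sq_pow_eq_zero hl) (by linarith) (by linarith)

/-- The alternating sum is an exponential sum with exponents `(i - j)²` and `m` vanishing moments,
so its Mellin transform at `-ν` is known. This is where the logarithmic and the pure power form of
the irregular term come from. -/
theorem integral_rpow_mul_altSum {ν : ℝ} (hν : 0 < ν) (hm : ν < m) :
    ∫ v in Set.Ioi (0 : ℝ), v ^ (-ν - 1) * altSum m (fun x => Real.exp (-v * x ^ 2))
      = Real.Gamma ν * 4 ^ ν * irregularSum ν m := by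
  have hΓ : 0 < Real.Gamma ν := Real.Gamma_pos_of_pos hν
  have hΓ1 : 0 < Real.Gamma (ν + 1) := Real.Gamma_pos_of_pos (by linarith)
  have h4 : (4 : ℝ) ^ ν = 2 ^ (2 * ν) := by
    rw [Real.rpow_mul (by norm_num)]; norm_num
  have h2 : (0 : ℝ) < 2 ^ (2 * ν) := by positivity
  have hsum : irregularSum ν m = ∑ k ∈ Finset.range (m + 1) ×ˢ Finset.range (m + 1),
      ((-1) ^ (k.1 + k.2) * (m.choose k.1 : ℝ) * (m.choose k.2 : ℝ))
        * irregularTerm ν |(k.1 : ℝ) - k.2| := altSum_eq_sum_product m fun y => irregularTerm ν |y|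
  have hpow : ∀ y : ℝ, |y| ^ (2 * ν) = (y ^ 2) ^ ν := fun y => by
    rw [Real.rpow_mul (abs_nonneg y), Real.rpow_two, sq_abs]
  simp only [altSum_gaussian_eq_expSum]
  rw [hsum, Finset.mul_sum]
  by_cases hint : ∃ k : ℤ, ν = k
  · obtain ⟨k, hk⟩ := hint
    obtain ⟨n, rfl⟩ : ∃ n : ℕ, ν = n := by
      have : 0 < k := by rw [hk] at hν; exact_mod_cast hν
      exact ⟨k.toNat, by rw [hk]; exact_mod_cast (Int.toNat_of_nonneg this.le).symm⟩
    have hn : n ≠ 0 := by rintro rfl; simp at hν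
    have hnm : n < m := by exact_mod_cast hm
    rw [integral_rpow_mul_expSum_nat (fun k _ => by positivity) n
      (fun l hl => sum_product_sq_pow_eq_zero (by omega)) (fun h => absurd h hn), Finset.mul_sum]
    refine Finset.sum_congr rfl fun k _ => ?_
    rw [irregularTerm, if_pos ⟨n, by simp⟩, Nat.floor_natCast, hpow, h4, Real.rpow_natCast,
      Real.log_pow, Real.log_abs, Real.Gamma_nat_eq_factorial, Real.rpow_sub_one (by norm_num)]
    have : (n.factorial : ℝ) ≠ 0 := by positivity
    field_simp
    push_cast
    ring
  · have hfl1 := Nat.floor_le hν.le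
    have hfl2 := Nat.lt_floor_add_one ν
    have hne : (⌊ν⌋₊ : ℝ) ≠ ν := fun h => hint ⟨⌊ν⌋₊, by rw [← h]; simp⟩
    have hlt : (⌊ν⌋₊ : ℝ) < ν := lt_of_le_of_ne hfl1 hne
    have hflm : ⌊ν⌋₊ < m := by exact_mod_cast hlt.trans hm
    -- The point `-ν` lies in the strip with `n = ⌊ν⌋₊ + 1`, and `⌊ν⌋₊ < m` supplies the moments.
    -- The reflection formula below rewrites `Γ(-ν)` through `sin (ν π)`.
    rw [integral_rpow_mul_expSum_of_ne (fun k _ => by positivity) (⌊ν⌋₊ + 1)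
      (fun l hl => sum_product_sq_pow_eq_zero (by omega)) (by simp) (s := -ν)
      (by push_cast; linarith) (by push_cast; linarith), Finset.mul_sum]
    refine Finset.sum_congr rfl fun k _ => ?_
    rw [irregularTerm, if_neg hint, hpow, h4, neg_neg]
    have hsin : Real.sin (ν * Real.pi) ≠ 0 := by
      rw [Ne, Real.sin_eq_zero_iff]
      rintro ⟨j, hj⟩
      exact hint ⟨j, (mul_right_cancel₀ Real.pi_ne_zero hj).symm⟩
    have hG := Real.Gamma_mul_Gamma_one_sub (-ν)
    rw [sub_neg_eq_add, add_comm 1 ν, mul_neg, Real.sin_neg, mul_comm Real.pi] at hG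
    have hG' : Real.Gamma (-ν) = Real.pi / -Real.sin (ν * Real.pi) / Real.Gamma (ν + 1) := by
      rw [← hG]; field_simp
    rw [hG']
    field_simp

/-- Up to a positive factor this is the integral of a nonnegative function that is positive for all
large `v`. -/
theorem irregularSum_pos {ν : ℝ} (hν : 0 < ν) (hm : ν < m) : 0 < irregularSum ν m := by
  have hΓ : 0 < Real.Gamma ν := Real.Gamma_pos_of_pos hν
  have hpos : 0 < ∫ v in Set.Ioi (0 : ℝ),
      v ^ (-ν - 1) * altSum m (fun x => Real.exp (-v * x ^ 2)) := by
    rw [setIntegral_pos_iff_support_of_nonneg_ae _ (integrableOn_rpow_mul_altSum hν hm)]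
    · obtain ⟨V, hV⟩ := eventually_atTop.1 (eventually_altSum_gaussian_pos m)
      refine lt_of_lt_of_le ?_ (measure_mono (?_ : Set.Ioi (max V 0) ⊆ _))
      · simp
      · intro v hv
        have hv' : max V 0 < v := hv
        have hv0 : 0 < v := (le_max_right _ _).trans_lt hv'
        refine ⟨?_, hv0⟩
        exact (mul_pos (Real.rpow_pos_of_pos hv0 _)
          (hV v ((le_max_left _ _).trans hv'.le))).ne'
    · refine (ae_restrict_iff' measurableSet_Ioi).2 (Eventually.of_forall fun v (hv : 0 < v) => ?_)
      exact mul_nonneg (Real.rpow_nonneg hv.le _) (altSum_gaussian_nonneg m hv.le)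
  rw [integral_rpow_mul_altSum hν hm] at hpos
  exact pos_of_mul_pos_right hpos (by positivity)

end AltSum

/-! ### Decay of covariances of rescaled increments -/

section Mixture

variable {E : Type*} [NormedAddCommGroup E] [InnerProductSpace ℝ E]

theorem altSum_matern_eq_mixture {σ α ν c : ℝ} (hα : 0 < α) (hν : 0 < ν) (hc : 0 < c) (m : ℕ)
    (w e : E) :
    altSum m (fun s => maternCov σ α ν (c * ‖w + s • e‖))
      = σ ^ 2 * (α * c) ^ (2 * ν) / (Real.Gamma ν * 4 ^ ν) *
        ∫ v in Set.Ioi (0 : ℝ), v ^ (-ν - 1) * Real.exp (-((α * c) ^ 2 / 4) / v)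
          * altSum m (fun s => Real.exp (-v * ‖w + s • e‖ ^ 2)) := by
  have hint : ∀ (i j : ℕ) (K : ℝ), IntegrableOn (fun v : ℝ => K *
      (v ^ (-ν - 1) * Real.exp (-((α * c) ^ 2 / 4) / v)
        * Real.exp (-v * ‖w + ((i : ℝ) - j) • e‖ ^ 2))) (Set.Ioi 0) := fun i j K =>
    (integrableOn_maternMixture hν (by positivity) (by positivity)).const_mul K
  have h1 : ∀ v : ℝ, v ^ (-ν - 1) * Real.exp (-((α * c) ^ 2 / 4) / v)
          * altSum m (fun s => Real.exp (-v * ‖w + s • e‖ ^ 2))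
      = ∑ i ∈ Finset.range (m + 1), ∑ j ∈ Finset.range (m + 1),
        (-1) ^ (i + j) * (m.choose i : ℝ) * (m.choose j : ℝ) *
      (v ^ (-ν - 1) * Real.exp (-((α * c) ^ 2 / 4) / v)
        * Real.exp (-v * ‖w + ((i : ℝ) - j) • e‖ ^ 2)) := by
    intro v
    simp only [altSum, Finset.mul_sum]
    exact Finset.sum_congr rfl fun i _ => Finset.sum_congr rfl fun j _ => by ring
  simp only [h1]
  rw [integral_finsetSum _ fun i _ => integrable_finsetSum _ fun j _ => hint i j _]
  simp_rw [integral_finsetSum _ fun j _ => hint _ j _, integral_const_mul]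
  simp only [altSum, Finset.mul_sum]
  refine Finset.sum_congr rfl fun i _ => Finset.sum_congr rfl fun j _ => ?_
  rw [maternCov_eq_mixture hα hν hc (norm_nonneg _)]
  ring

theorem continuous_altSum_gaussian_norm (m : ℕ) (w e : E) :
    Continuous fun v : ℝ => altSum m (fun s => Real.exp (-v * ‖w + s • e‖ ^ 2)) := by
  unfold altSum
  fun_prop

/-- Covariances of rescaled Matérn increments decay polynomially in the rescaled distance. -/
theorem exists_abs_altSum_matern_le {σ α ν r : ℝ} (hα : 0 < α) (hν : 0 < ν) (hr : 0 < r) {m : ℕ}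
    {κ : ℝ} (hκ : 0 ≤ κ) (hm : ν + κ / 2 < m) :
    ∃ C : ℝ, 0 ≤ C ∧ ∀ (n : ℕ) (w e : E), 0 < n → ‖e‖ = 1 →
      |(n : ℝ) ^ (2 * ν) * altSum m (fun s => maternCov σ α ν (r / n * ‖w + s • e‖))|
        ≤ C * (1 + ‖w‖) ^ (-κ) := by
  obtain ⟨C, hC0, hC⟩ := exists_abs_altSum_gaussian_le (E := E) m
  have hmν : 0 < (m : ℝ) - ν := by linarith
  have hm1 : (1 : ℝ) ≤ m := by
    have : 0 < m := by
      have : (0 : ℝ) < m := by linarith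
      exact_mod_cast this
    exact_mod_cast this
  have hΓ : 0 < Real.Gamma ν := Real.Gamma_pos_of_pos hν
  have hΓm : 0 < Real.Gamma (m - ν) := Real.Gamma_pos_of_pos hmν
  set K : ℝ := σ ^ 2 * (α * r) ^ (2 * ν) / (Real.Gamma ν * 4 ^ ν) with hK
  have hK0 : 0 ≤ K := by positivity
  have hnear : ∀ (w e : E) (v : ℝ), 0 < v → ‖e‖ = 1 →
      |altSum m (fun s => Real.exp (-v * ‖w + s • e‖ ^ 2))| ≤ C * v ^ m := by
    intro w e v hv he
    simpa using hC w e v 0 hv he fun s _ => by positivity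
  have htriv : ∀ (w e : E) (v : ℝ), 0 < v →
      |altSum m (fun s => Real.exp (-v * ‖w + s • e‖ ^ 2))| ≤ 4 ^ m := by
    intro w e v hv
    refine (abs_altSum_le (B := 1) fun s => ?_).trans_eq (mul_one _)
    rw [Real.abs_exp, Real.exp_le_one_iff]
    nlinarith [mul_nonneg hv.le (sq_nonneg ‖w + s • e‖)]
  have hint : ∀ w e : E, ‖e‖ = 1 → IntegrableOn (fun v : ℝ => v ^ (-ν - 1) *
      |altSum m (fun s => Real.exp (-v * ‖w + s • e‖ ^ 2))|) (Set.Ioi 0) := by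
    intro w e he
    refine integrableOn_rpow_mul_of_bounds (s := -ν) (a := m) (b := 0) (A := C) (B := 4 ^ m)
      (continuous_altSum_gaussian_norm m w e).abs.aestronglyMeasurable (by linarith)
      (by linarith) (fun v hv => ?_) fun v hv => ?_
    · rw [abs_abs, Real.rpow_natCast]; exact hnear w e v hv he
    · rw [abs_abs, Real.rpow_zero, mul_one]; exact htriv w e v hv
  -- The power of `n` cancels, and the remaining dependence on `n` is an exponential factor at most
  -- `1`. Dropping it makes the bound uniform in `n`.
  have hscale : ∀ (n : ℕ) (w e : E), 0 < n → ‖e‖ = 1 →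
      |(n : ℝ) ^ (2 * ν) * altSum m (fun s => maternCov σ α ν (r / n * ‖w + s • e‖))|
      ≤ K * ∫ v in Set.Ioi (0 : ℝ), v ^ (-ν - 1) *
        |altSum m (fun s => Real.exp (-v * ‖w + s • e‖ ^ 2))| := by
    intro n w e hn he
    have hn' : (0 : ℝ) < n := by exact_mod_cast hn
    rw [altSum_matern_eq_mixture hα hν (div_pos hr hn'), ← mul_assoc]
    have h1 : (n : ℝ) ^ (2 * ν) * (σ ^ 2 * (α * (r / n)) ^ (2 * ν) / (Real.Gamma ν * 4 ^ ν)) = K := by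
      rw [hK, ← mul_div_assoc α, Real.div_rpow (by positivity) hn'.le]
      have : (0 : ℝ) < (n : ℝ) ^ (2 * ν) := by positivity
      field_simp
    rw [h1, abs_mul, abs_of_nonneg hK0]
    refine mul_le_mul_of_nonneg_left ?_ hK0
    rw [← Real.norm_eq_abs]
    refine norm_integral_le_of_norm_le ?_ ?_
    · exact hint w e he
    · refine (ae_restrict_iff' measurableSet_Ioi).2
        (Eventually.of_forall fun v (hv : 0 < v) => ?_)
      rw [norm_mul, norm_mul, Real.norm_of_nonneg (Real.exp_pos _).le,
        Real.norm_of_nonneg (Real.rpow_nonneg hv.le _), Real.norm_eq_abs]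
      gcongr
      refine mul_le_of_le_one_right (by positivity) (Real.exp_le_one_iff.2 ?_)
      rw [neg_div]
      have : 0 ≤ (α * (r / n)) ^ 2 / 4 / v := by positivity
      linarith
  set g : ℝ → ℝ := fun v => min (4 ^ m) (C * v ^ m) with hg
  have hgi : IntegrableOn (fun v => v ^ (-ν - 1) * g v) (Set.Ioi 0) := by
    refine integrableOn_rpow_mul_of_bounds (s := -ν) (a := m) (b := 0) (A := C) (B := 4 ^ m)
      (by fun_prop) (by linarith) (by linarith) (fun v hv => ?_) fun v hv => ?_
    · rw [abs_of_nonneg (le_min (by positivity) (by positivity)), Real.rpow_natCast]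
      exact min_le_right _ _
    · rw [abs_of_nonneg (le_min (by positivity) (by positivity)), Real.rpow_zero, mul_one]
      exact min_le_left _ _
  set B : ℝ := ∫ v in Set.Ioi (0 : ℝ), v ^ (-ν - 1) * g v
  have hB0 : 0 ≤ B := setIntegral_nonneg measurableSet_Ioi fun v (hv : 0 < v) =>
    mul_nonneg (Real.rpow_nonneg hv.le _) (le_min (by positivity) (by positivity))
  refine ⟨K * (B * (1 + 2 * m) ^ κ) + K * (C * (8 ^ (m - ν) * Real.Gamma (m - ν) * 2 ^ κ)),
    by positivity, fun n w e hn he => (hscale n w e hn he).trans ?_⟩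
  have hρ : 0 < 1 + ‖w‖ := by positivity
  -- For `‖w‖ ≤ 2 m` a uniform bound suffices. Otherwise `‖w + s • e‖ ≥ ‖w‖ / 2` whenever `|s| ≤ m`,
  -- so the kernel differences decay exponentially, and a Gamma integral gives `‖w‖ ^ (-2 (m - ν))`.
  rcases le_or_gt ‖w‖ (2 * m) with hw | hw
  · have h1 : ∫ v in Set.Ioi (0 : ℝ), v ^ (-ν - 1) *
        |altSum m (fun s => Real.exp (-v * ‖w + s • e‖ ^ 2))| ≤ B := by
      refine setIntegral_mono_on (hint w e he) hgi measurableSet_Ioi fun v (hv : 0 < v) => ?_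
      gcongr
      exact le_min (htriv w e v hv) (hnear w e v hv he)
    have h2 : B ≤ B * (1 + 2 * m) ^ κ * (1 + ‖w‖) ^ (-κ) := by
      rw [mul_assoc]
      refine le_mul_of_one_le_right hB0 ?_
      rw [Real.rpow_neg hρ.le, ← div_eq_mul_inv, ← Real.div_rpow (by positivity) hρ.le]
      refine Real.one_le_rpow ?_ hκ
      rw [one_le_div hρ]
      linarith
    calc _ ≤ K * (B * (1 + 2 * m) ^ κ * (1 + ‖w‖) ^ (-κ)) := by gcongr; exact h1.trans h2
      _ ≤ _ := by
        rw [add_mul, ← mul_assoc K _ ((1 + ‖w‖) ^ (-κ))]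
        exact le_add_of_nonneg_right (by positivity)
  · have hw1 : 1 ≤ ‖w‖ := by linarith
    have hw0 : 0 < ‖w‖ := by linarith
    have hfar : ∀ v, 0 < v → |altSum m (fun s => Real.exp (-v * ‖w + s • e‖ ^ 2))|
        ≤ C * v ^ m * Real.exp (-v * (‖w‖ ^ 2 / 4 / 2)) := by
      intro v hv
      refine hC w e v _ hv he fun s hs => ?_
      have h1 : ‖w‖ - |s| ≤ ‖w + s • e‖ := by
        have := norm_sub_norm_le w (-(s • e))
        rwa [norm_neg, norm_smul, he, mul_one, sub_neg_eq_add, Real.norm_eq_abs] at this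
      nlinarith [norm_nonneg w]
    have hrate : 0 < ‖w‖ ^ 2 / 8 := by positivity
    have hfi : IntegrableOn (fun v : ℝ => C * (v ^ (m - ν - 1) * Real.exp (-(‖w‖ ^ 2 / 8 * v))))
        (Set.Ioi 0) := by
      have := integrableOn_rpow_mul_exp_neg_mul_rpow (s := m - ν - 1) (by linarith) one_pos hrate
      simp only [Real.rpow_one, neg_mul] at this
      exact this.const_mul C
    have h1 : ∫ v in Set.Ioi (0 : ℝ), v ^ (-ν - 1) *
        |altSum m (fun s => Real.exp (-v * ‖w + s • e‖ ^ 2))|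
        ≤ C * ((1 / (‖w‖ ^ 2 / 8)) ^ (m - ν) * Real.Gamma (m - ν)) := by
      rw [← Real.integral_rpow_mul_exp_neg_mul_Ioi hmν hrate, ← integral_const_mul]
      refine setIntegral_mono_on (hint w e he) hfi measurableSet_Ioi fun v (hv : 0 < v) => ?_
      calc _ ≤ v ^ (-ν - 1) * (C * v ^ m * Real.exp (-v * (‖w‖ ^ 2 / 4 / 2))) := by
            gcongr; exact hfar v hv
        _ = _ := by
            rw [show (m : ℝ) - ν - 1 = (-ν - 1) + m by ring, Real.rpow_add hv, Real.rpow_natCast,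
              show -v * (‖w‖ ^ 2 / 4 / 2) = -(‖w‖ ^ 2 / 8 * v) by ring]
            ring
    have h2 : (1 / (‖w‖ ^ 2 / 8)) ^ (m - ν) ≤ 8 ^ (m - ν) * (2 ^ κ * (1 + ‖w‖) ^ (-κ)) := by
      rw [one_div_div, Real.div_rpow (by norm_num) (by positivity), div_eq_mul_inv]
      gcongr
      rw [← Real.rpow_two, ← Real.rpow_mul hw0.le, ← Real.rpow_neg hw0.le]
      calc ‖w‖ ^ (-(2 * ((m : ℝ) - ν))) ≤ ‖w‖ ^ (-κ) :=
            Real.rpow_le_rpow_of_exponent_le hw1 (by linarith)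
        _ ≤ ((1 + ‖w‖) / 2) ^ (-κ) :=
            Real.rpow_le_rpow_of_nonpos (by positivity) (by linarith) (by linarith)
        _ = 2 ^ κ * (1 + ‖w‖) ^ (-κ) := by
            rw [Real.div_rpow hρ.le (by norm_num), Real.rpow_neg (by norm_num : (0 : ℝ) ≤ 2)]
            field_simp
    calc _ ≤ K * (C * ((8 ^ (m - ν) * (2 ^ κ * (1 + ‖w‖) ^ (-κ))) * Real.Gamma (m - ν))) := by
          gcongr
          exact h1.trans (by gcongr)
      _ = K * (C * (8 ^ (m - ν) * Real.Gamma (m - ν) * 2 ^ κ)) * (1 + ‖w‖) ^ (-κ) := by ring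
      _ ≤ _ := by
        rw [add_mul]
        exact le_add_of_nonneg_left (by positivity)

end Mixture

/-! ### Second order expansion of the variance -/

theorem tendsto_sq_mul_exp_sub_one (b : ℝ) (hb : 0 ≤ b) :
    Tendsto (fun n : ℕ => (n : ℝ) ^ 2 * (Real.exp (-(b / (n : ℝ) ^ 2)) - 1)) atTop (𝓝 (-b)) := by
  have h1 : Tendsto (fun n : ℕ => b ^ 2 / (n : ℝ) ^ 2) atTop (𝓝 0) :=
    tendsto_const_nhds.div_atTop
      ((tendsto_pow_atTop two_ne_zero).comp tendsto_natCast_atTop_atTop)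
  have h2 : Tendsto (fun n : ℕ => -b + b ^ 2 / (n : ℝ) ^ 2) atTop (𝓝 (-b)) := by
    simpa using h1.const_add (-b)
  refine tendsto_of_tendsto_of_tendsto_of_le_of_le' tendsto_const_nhds h2 ?_ ?_
  · filter_upwards [eventually_gt_atTop 0] with n hn
    have hn' : (0 : ℝ) < n := by exact_mod_cast hn
    have := Real.add_one_le_exp (-(b / (n : ℝ) ^ 2))
    have h3 : (n : ℝ) ^ 2 * (b / (n : ℝ) ^ 2) = b := by field_simp
    nlinarith [sq_nonneg (n : ℝ)]
  · filter_upwards [eventually_gt_atTop 0] with n hn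
    have hn' : (0 : ℝ) < n := by exact_mod_cast hn
    set x := b / (n : ℝ) ^ 2 with hx
    have hx0 : 0 ≤ x := by positivity
    have h3 : (n : ℝ) ^ 2 * x = b := by rw [hx]; field_simp
    have h4 : b ^ 2 / (n : ℝ) ^ 2 = (n : ℝ) ^ 2 * x ^ 2 := by rw [hx]; field_simp
    -- From `1 + x ≤ exp x` and `(1 + x) (1 - x + x²) = 1 + x³ ≥ 1`.
    have h5 : Real.exp (-x) ≤ 1 - x + x ^ 2 := by
      rw [Real.exp_neg]
      have h6 := Real.add_one_le_exp x
      rw [inv_le_comm₀ (Real.exp_pos x) (by nlinarith [sq_nonneg (x - 1)])]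
      refine le_trans ?_ h6
      rw [inv_le_iff_one_le_mul₀ (by nlinarith [sq_nonneg (x - 1)])]
      nlinarith [pow_nonneg hx0 3]
    rw [h4]
    nlinarith [sq_nonneg (n : ℝ)]

/-- Dominated convergence: `n² |exp (-b / (v n²)) - 1| ≤ b / v`, and the extra `v⁻¹` stays
integrable against the alternating sum because `ν + 1 < m`. -/
theorem tendsto_sq_mul_integral_mixture_sub {ν b : ℝ} (hν : 0 < ν) (hb : 0 ≤ b) {m : ℕ}
    (hm : ν + 1 < m) :
    Tendsto (fun n : ℕ => (n : ℝ) ^ 2 *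
      ((∫ v in Set.Ioi (0 : ℝ), v ^ (-ν - 1) * Real.exp (-(b / (n : ℝ) ^ 2) / v)
          * altSum m (fun x => Real.exp (-v * x ^ 2)))
        - ∫ v in Set.Ioi (0 : ℝ), v ^ (-ν - 1) * altSum m (fun x => Real.exp (-v * x ^ 2))))
      atTop (𝓝 (-b * ∫ v in Set.Ioi (0 : ℝ),
        v ^ (-(ν + 1) - 1) * altSum m (fun x => Real.exp (-v * x ^ 2)))) := by
  have hD := (continuous_altSum_gaussian m).aestronglyMeasurable (μ := volume.restrict (Set.Ioi 0))
  have hi0 := integrableOn_rpow_mul_altSum hν (show ν < m by linarith)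
  have hi1 := integrableOn_rpow_mul_altSum (show 0 < ν + 1 by linarith) hm
  have hexp : ∀ (n : ℕ) (v : ℝ), 0 < v → Real.exp (-(b / (n : ℝ) ^ 2) / v) ≤ 1 := by
    intro n v hv
    rw [Real.exp_le_one_iff, neg_div]
    have : 0 ≤ b / (n : ℝ) ^ 2 / v := by positivity
    linarith
  have hin : ∀ n : ℕ, IntegrableOn (fun v : ℝ => v ^ (-ν - 1) *
      Real.exp (-(b / (n : ℝ) ^ 2) / v) * altSum m (fun x => Real.exp (-v * x ^ 2)))
      (Set.Ioi 0) := by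
    intro n
    refine hi0.norm.mono' (AEStronglyMeasurable.mul (by fun_prop) hD) ?_
    refine (ae_restrict_iff' measurableSet_Ioi).2 (Eventually.of_forall fun v (hv : 0 < v) => ?_)
    rw [norm_mul, norm_mul, norm_mul, Real.norm_of_nonneg (Real.exp_pos _).le]
    have := hexp n v hv
    calc _ ≤ ‖v ^ (-ν - 1)‖ * 1 * ‖altSum m (fun x => Real.exp (-v * x ^ 2))‖ := by gcongr
      _ = _ := by rw [mul_one]
  have hrw : ∀ n : ℕ, (n : ℝ) ^ 2 *
      ((∫ v in Set.Ioi (0 : ℝ), v ^ (-ν - 1) * Real.exp (-(b / (n : ℝ) ^ 2) / v)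
          * altSum m (fun x => Real.exp (-v * x ^ 2)))
        - ∫ v in Set.Ioi (0 : ℝ), v ^ (-ν - 1) * altSum m (fun x => Real.exp (-v * x ^ 2)))
      = ∫ v in Set.Ioi (0 : ℝ), (n : ℝ) ^ 2 * (Real.exp (-(b / v / (n : ℝ) ^ 2)) - 1)
        * (v ^ (-ν - 1) * altSum m (fun x => Real.exp (-v * x ^ 2))) := by
    intro n
    rw [← integral_sub (hin n) hi0, ← integral_const_mul]
    refine integral_congr_ae (Eventually.of_forall fun v => ?_)
    simp only
    rw [neg_div, div_right_comm]
    ring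
  simp only [hrw]
  rw [← integral_const_mul]
  have hpow : ∀ v : ℝ, 0 < v → v ^ (-ν - 1) = v * v ^ (-(ν + 1) - 1) := fun v hv => by
    rw [show -ν - 1 = (-(ν + 1) - 1) + 1 by ring, Real.rpow_add_one hv.ne']; ring
  refine tendsto_integral_of_dominated_convergence
    (fun v => b * ‖v ^ (-(ν + 1) - 1) * altSum m (fun x => Real.exp (-v * x ^ 2))‖)
    (fun n => AEStronglyMeasurable.mul (by fun_prop) (AEStronglyMeasurable.mul (by fun_prop) hD))
    (hi1.norm.const_mul b) (fun n => ?_) ?_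
  · refine (ae_restrict_iff' measurableSet_Ioi).2 (Eventually.of_forall fun v (hv : 0 < v) => ?_)
    have h1 : |(n : ℝ) ^ 2 * (Real.exp (-(b / v / (n : ℝ) ^ 2)) - 1)| ≤ b / v := by
      rcases n.eq_zero_or_pos with rfl | hn
      · simp; positivity
      · have hn' : (0 : ℝ) < n := by exact_mod_cast hn
        have h2 := Real.add_one_le_exp (-(b / v / (n : ℝ) ^ 2))
        have h3 : Real.exp (-(b / v / (n : ℝ) ^ 2)) ≤ 1 := Real.exp_le_one_iff.2 (by
          have : 0 ≤ b / v / (n : ℝ) ^ 2 := by positivity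
          linarith)
        rw [abs_mul, abs_of_nonneg (by positivity), abs_of_nonpos (by linarith)]
        calc (n : ℝ) ^ 2 * -(Real.exp (-(b / v / (n : ℝ) ^ 2)) - 1)
            ≤ (n : ℝ) ^ 2 * (b / v / (n : ℝ) ^ 2) := by gcongr; linarith
          _ = b / v := by field_simp
    rw [norm_mul, Real.norm_eq_abs, norm_mul, norm_mul, hpow v hv, norm_mul,
      Real.norm_of_nonneg hv.le]
    calc _ ≤ b / v * (v * ‖v ^ (-(ν + 1) - 1)‖ * ‖altSum m (fun x => Real.exp (-v * x ^ 2))‖) := by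
          gcongr
      _ = _ := by field_simp
  · refine (ae_restrict_iff' measurableSet_Ioi).2 (Eventually.of_forall fun v (hv : 0 < v) => ?_)
    have h1 := (tendsto_sq_mul_exp_sub_one (b / v) (by positivity)).mul_const
      (v ^ (-ν - 1) * altSum m (fun x => Real.exp (-v * x ^ 2)))
    convert h1 using 2
    rw [hpow v hv]
    field_simp

/-- Second order expansion of the variance of rescaled Matérn increments. -/
theorem tendsto_sq_mul_altSum_matern_sub {σ α ν r : ℝ} (hα : 0 < α) (hν : 0 < ν) (hr : 0 < r)
    {m : ℕ} (hm : ν + 1 < m) :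
    Tendsto (fun n : ℕ => (n : ℝ) ^ 2 *
      ((n : ℝ) ^ (2 * ν) * altSum m (fun s => maternCov σ α ν (r / n * |s|))
        - σ ^ 2 * α ^ (2 * ν) * r ^ (2 * ν) * irregularSum ν m))
      atTop (𝓝 (σ ^ 2 * α ^ (2 * ν + 2) * r ^ (2 * ν + 2) * (-ν * irregularSum (ν + 1) m))) := by
  have hΓ : 0 < Real.Gamma ν := Real.Gamma_pos_of_pos hν
  have h4 : (0 : ℝ) < 4 ^ ν := by positivity
  have h := (tendsto_sq_mul_integral_mixture_sub hν (b := (α * r) ^ 2 / 4) (by positivity) hm).const_mul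
    (σ ^ 2 * (α * r) ^ (2 * ν) / (Real.Gamma ν * 4 ^ ν))
  rw [integral_rpow_mul_altSum hν (by linarith), integral_rpow_mul_altSum (by linarith) hm] at h
  -- The ratio of `Γ(ν + 1) 4 ^ (ν + 1)` to `Γ(ν) 4 ^ ν` is `4 ν`; with `-(α r)² / 4` it leaves the
  -- factor `-ν (α r)²`.
  have hlim : σ ^ 2 * (α * r) ^ (2 * ν) / (Real.Gamma ν * 4 ^ ν) * (-((α * r) ^ 2 / 4) *
      (Real.Gamma (ν + 1) * 4 ^ (ν + 1) * irregularSum (ν + 1) m))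
      = σ ^ 2 * α ^ (2 * ν + 2) * r ^ (2 * ν + 2) * (-ν * irregularSum (ν + 1) m) := by
    rw [Real.Gamma_add_one hν.ne', Real.rpow_add_one (by norm_num : (4 : ℝ) ≠ 0),
      Real.mul_rpow hα.le hr.le, Real.rpow_add hα, Real.rpow_add hr, Real.rpow_two, Real.rpow_two]
    field_simp
  rw [hlim] at h
  refine h.congr' ?_
  filter_upwards [eventually_gt_atTop 0] with n hn
  have hn' : (0 : ℝ) < n := by exact_mod_cast hn
  have h1 : altSum m (fun s => maternCov σ α ν (r / n * |s|))
      = altSum m (fun s => maternCov σ α ν (r / n * ‖(0 : ℝ) + s • (1 : ℝ)‖)) := by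
    simp
  rw [h1, altSum_matern_eq_mixture hα hν (div_pos hr hn')]
  have h2 : (α * (r / n)) ^ 2 / 4 = (α * r) ^ 2 / 4 / (n : ℝ) ^ 2 := by field_simp
  have h3 : (α * (r / n)) ^ (2 * ν) = α ^ (2 * ν) * r ^ (2 * ν) / (n : ℝ) ^ (2 * ν) := by
    rw [← mul_div_assoc, Real.div_rpow (by positivity) hn'.le, Real.mul_rpow hα.le hr.le]
  simp only [zero_add, smul_eq_mul, mul_one, Real.norm_eq_abs, sq_abs]
  rw [h2, h3, Real.mul_rpow hα.le hr.le]
  have h5 : (0 : ℝ) < (n : ℝ) ^ (2 * ν) := by positivity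
  generalize (∫ v in Set.Ioi (0 : ℝ), v ^ (-ν - 1) *
    Real.exp (-((α * r) ^ 2 / 4 / (n : ℝ) ^ 2) / v) *
      altSum m (fun x => Real.exp (-v * x ^ 2))) = I
  field_simp

/-! ### Moments of Gaussian quadratic forms -/

theorem integral_exp_mul_sq_gaussianReal (v : NNReal) {s : ℝ} (hs : 2 * s * v < 1) :
    ∫ x, Real.exp (s * x ^ 2) ∂(gaussianReal 0 v) = (Real.sqrt (1 - 2 * s * v))⁻¹ := by
  rcases eq_or_ne v 0 with rfl | hv
  · simp [gaussianReal_zero_var]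
  · have hv' : (0 : ℝ) < v := by positivity
    have hb : 0 < 1 - 2 * s * v := by linarith
    rw [integral_gaussianReal_eq_integral_smul hv]
    have h1 : ∀ x : ℝ, gaussianPDFReal 0 v x • Real.exp (s * x ^ 2)
        = (Real.sqrt (2 * Real.pi * v))⁻¹ * Real.exp (-((1 - 2 * s * v) / (2 * v)) * x ^ 2) := by
      intro x
      rw [gaussianPDFReal, smul_eq_mul, mul_assoc, ← Real.exp_add]
      congr 2
      field_simp
      ring
    simp_rw [h1]
    rw [integral_const_mul, integral_gaussian, ← Real.sqrt_inv, ← Real.sqrt_inv,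
      ← Real.sqrt_mul (by positivity)]
    congr 1
    field_simp

/-- With `y = 2 s V` the moment generating function is `exp (-y / 2) (1 - y) ^ (-1 / 2)`, and `(1 -
y)⁻¹ ≤ exp (y + 2 y²)` for `|y| ≤ 1 / 2`. -/
theorem mgf_sq_sub_le {Ω' : Type*} [MeasurableSpace Ω'] {P : Measure Ω'} {Z : Ω' → ℝ}
    (hZ : HasGaussianLaw Z P) (h0 : ∫ ω, Z ω ∂P = 0) {s : ℝ} (hs : |s| * Var[Z; P] ≤ 1 / 4) :
    Integrable (fun ω => Real.exp (s * (Z ω ^ 2 - Var[Z; P]))) P ∧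
    mgf (fun ω => Z ω ^ 2 - Var[Z; P]) P s ≤ Real.exp (4 * s ^ 2 * Var[Z; P] ^ 2) := by
  set V : ℝ := Var[Z; P] with hV
  have hV0 : 0 ≤ V := variance_nonneg Z P
  have hlaw := hZ.map_eq_gaussianReal
  rw [h0] at hlaw
  have hcoe : ((V.toNNReal : NNReal) : ℝ) = V := Real.coe_toNNReal V hV0
  set y : ℝ := 2 * s * V with hy
  have hy2 : |y| ≤ 1 / 2 := by
    rw [hy, abs_mul, abs_mul, abs_of_nonneg hV0, abs_two]; linarith
  obtain ⟨hy3, hy4⟩ := abs_le.1 hy2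
  have hy1 : 0 < 1 - y := by linarith
  have hint : ∫ ω, Real.exp (s * Z ω ^ 2) ∂P = (Real.sqrt (1 - y))⁻¹ := by
    have h1 := integral_exp_mul_sq_gaussianReal V.toNNReal (s := s) (by rw [hcoe]; linarith)
    rw [← hlaw, integral_map hZ.aemeasurable (by fun_prop), hcoe] at h1
    exact h1
  have hexp : ∀ ω, Real.exp (s * (Z ω ^ 2 - V)) = Real.exp (-(y / 2)) * Real.exp (s * Z ω ^ 2) := by
    intro ω
    rw [← Real.exp_add]
    congr 1
    rw [hy]; ring
  -- A non-integrable function has integral `0` by convention, while the value just computed is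
  -- positive.
  have hi : Integrable (fun ω => Real.exp (s * Z ω ^ 2)) P := by
    by_contra hcon
    rw [integral_undef hcon] at hint
    exact (inv_pos.2 (Real.sqrt_pos.2 hy1)).ne hint
  simp only [mgf, hexp]
  refine ⟨hi.const_mul _, ?_⟩
  rw [integral_const_mul, hint]
  have h2 : (1 - y)⁻¹ ≤ Real.exp (y + 2 * y ^ 2) := by
    have h3 := Real.add_one_le_exp (y / (1 - y))
    have h4 : y / (1 - y) ≤ y + 2 * y ^ 2 := by
      rw [div_le_iff₀ hy1]; nlinarith [sq_nonneg y]
    calc (1 - y)⁻¹ = y / (1 - y) + 1 := by field_simp; ring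
      _ ≤ _ := h3.trans (Real.exp_le_exp.2 h4)
  have h5 : (Real.sqrt (1 - y))⁻¹ ≤ Real.exp ((y + 2 * y ^ 2) / 2) := by
    rw [← Real.sqrt_inv, Real.exp_half]
    exact Real.sqrt_le_sqrt h2
  calc Real.exp (-(y / 2)) * (Real.sqrt (1 - y))⁻¹
      ≤ Real.exp (-(y / 2)) * Real.exp ((y + 2 * y ^ 2) / 2) := by gcongr
    _ = Real.exp (4 * s ^ 2 * V ^ 2) := by
      rw [← Real.exp_add]; congr 1; rw [hy]; ring

/-- A real symmetric matrix is diagonal in an orthonormal basis. -/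
theorem exists_orthogonal_diagonalization {ι : Type*} [Fintype ι] [DecidableEq ι]
    {C : Matrix ι ι ℝ} (hC : C.IsHermitian) :
    ∃ (U : Matrix ι ι ℝ) (l : ι → ℝ), U * U.transpose = 1 ∧
      U.transpose * C * U = Matrix.diagonal l := by
  refine ⟨hC.eigenvectorUnitary, hC.eigenvalues, ?_, ?_⟩
  · have := Unitary.coe_mul_star_self hC.eigenvectorUnitary
    rwa [Unitary.coe_star, Matrix.star_eq_conjTranspose, Matrix.conjTranspose_eq_transpose_of_trivial] at this
  · have := hC.conjStarAlgAut_star_eigenvectorUnitary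
    rw [Unitary.conjStarAlgAut_star_apply, Matrix.star_eq_conjTranspose,
      Matrix.conjTranspose_eq_transpose_of_trivial] at this
    exact this

/-- Exponential integrability of a centred quadratic form in a centred Gaussian vector, at the
scale of the Frobenius norm of the covariance matrix. -/
theorem integral_exp_quadratic_le {Ω' : Type*} [MeasurableSpace Ω'] {P : Measure Ω'}
    [IsProbabilityMeasure P] {ι : Type*} [Fintype ι] {X : ι → Ω' → ℝ}
    (hX : HasGaussianLaw (fun ω => (X · ω)) P) (h0 : ∀ i, ∫ ω, X i ω ∂P = 0) {B : ℝ} (hB : 0 < B)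
    (hcov : ∑ i, ∑ j, cov[X i, X j; P] ^ 2 ≤ B ^ 2) {s : ℝ} (hs : |s| = 1 / (4 * B)) :
    Integrable (fun ω => Real.exp (s * ∑ i, (X i ω ^ 2 - Var[X i; P]))) P ∧
    ∫ ω, Real.exp (s * ∑ i, (X i ω ^ 2 - Var[X i; P])) ∂P ≤ Real.exp (1 / 4) := by
  classical
  have hmem : ∀ i, MemLp (X i) 2 P := fun i => (hX.eval i).memLp_two
  set C : Matrix ι ι ℝ := Matrix.of fun i j => cov[X i, X j; P] with hCdef
  have hCs : C.IsHermitian := by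
    ext i j
    simp [hCdef, covariance_comm]
  obtain ⟨U, l, hU1, hUC⟩ := exists_orthogonal_diagonalization hCs
  -- In the eigenbasis the coordinates are uncorrelated and jointly Gaussian, hence independent,
  -- with the eigenvalues as variances. The sum of squares, the trace and the Frobenius norm do not
  -- change.
  set Z : ι → Ω' → ℝ := fun i ω => ∑ j, U j i * X j ω with hZ
  have hZg : HasGaussianLaw (fun ω => (Z · ω)) P := by
    have := hX.map_fun ((Matrix.toLin' U.transpose).toContinuousLinearMap)
    refine this.congr (Eventually.of_forall fun ω => ?_)
    ext i
    simp [hZ, Matrix.mulVec, dotProduct, Matrix.transpose_apply]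
  have hZcov : ∀ i k, cov[Z i, Z k; P] = Matrix.diagonal l i k := by
    intro i k
    rw [← hUC, hZ]
    rw [covariance_fun_sum_fun_sum (fun j => (hmem j).const_mul _)
      (fun j => (hmem j).const_mul _)]
    simp only [covariance_const_mul_left, covariance_const_mul_right, Matrix.mul_apply,
      Matrix.transpose_apply, hCdef, Matrix.of_apply, Finset.sum_mul]
    rw [Finset.sum_comm]
    exact Finset.sum_congr rfl fun a _ => Finset.sum_congr rfl fun b _ => by ring
  have hZvar : ∀ i, Var[Z i; P] = l i := by
    intro i
    rw [← covariance_self (hZg.eval i).aemeasurable, hZcov, Matrix.diagonal_apply_eq]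
  have hZ0 : ∀ i, ∫ ω, Z i ω ∂P = 0 := by
    intro i
    simp only [hZ]
    rw [integral_finsetSum _ fun j _ => ((hX.eval j).integrable).const_mul _]
    simp [integral_const_mul, h0]
  have hindep : iIndepFun Z P := hZg.iIndepFun_of_covariance_eq_zero fun i j hij => by
    rw [hZcov, Matrix.diagonal_apply_ne _ hij]
  have hsq : ∀ ω, ∑ i, X i ω ^ 2 = ∑ i, Z i ω ^ 2 := by
    intro ω
    have h1 : (fun i => Z i ω) = U.transpose.mulVec fun j => X j ω := by
      ext i; simp [hZ, Matrix.mulVec, dotProduct, Matrix.transpose_apply]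
    have h2 : (fun i => Z i ω) ⬝ᵥ (fun i => Z i ω) = (fun j => X j ω) ⬝ᵥ fun j => X j ω := by
      rw [h1, Matrix.dotProduct_mulVec, Matrix.vecMul_transpose, Matrix.mulVec_mulVec, hU1,
        Matrix.one_mulVec]
    simp only [dotProduct, ← sq] at h2
    exact h2.symm
  have htr : ∑ i, Var[X i; P] = ∑ i, l i := by
    have h1 : C.trace = ∑ i, l i := by
      rw [← Matrix.trace_diagonal, ← hUC, Matrix.trace_mul_comm, ← Matrix.mul_assoc, hU1,
        Matrix.one_mul]
    rw [← h1, Matrix.trace]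
    exact Finset.sum_congr rfl fun i _ => (covariance_self (hX.eval i).aemeasurable).symm
  have hfrob : ∑ i, l i ^ 2 ≤ B ^ 2 := by
    have h1 : (C * C).trace = ∑ i, l i ^ 2 := by
      have h2 : (Matrix.diagonal l * Matrix.diagonal l).trace = ∑ i, l i ^ 2 := by
        rw [Matrix.diagonal_mul_diagonal, Matrix.trace_diagonal]
        exact Finset.sum_congr rfl fun i _ => (sq _).symm
      rw [← h2, ← hUC]
      have h3 : U.transpose * C * U * (U.transpose * C * U) = U.transpose * (C * C * U) := by
        calc _ = U.transpose * C * (U * U.transpose) * C * U := by simp only [Matrix.mul_assoc]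
          _ = _ := by rw [hU1, Matrix.mul_one]; simp only [Matrix.mul_assoc]
      rw [h3, Matrix.trace_mul_comm U.transpose, Matrix.mul_assoc (C * C), hU1, Matrix.mul_one]
    rw [← h1, Matrix.trace]
    refine le_trans (le_of_eq ?_) hcov
    refine Finset.sum_congr rfl fun i _ => ?_
    rw [Matrix.diag_apply, Matrix.mul_apply]
    refine Finset.sum_congr rfl fun j _ => ?_
    simp only [hCdef, Matrix.of_apply]
    rw [covariance_comm (X j), sq]
  have hlB : ∀ i, l i ≤ B := fun i => by
    have : l i ^ 2 ≤ B ^ 2 :=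
      (Finset.single_le_sum (f := fun i => l i ^ 2) (fun i _ => sq_nonneg _)
        (Finset.mem_univ i)).trans hfrob
    exact le_of_sq_le_sq this hB.le
  have hsl : ∀ i, |s| * Var[Z i; P] ≤ 1 / 4 := by
    intro i
    rw [hZvar, hs, div_mul_eq_mul_div, one_mul, div_le_div_iff₀ (by positivity) (by norm_num)]
    linarith [hlB i]
  set W : ι → Ω' → ℝ := fun i ω => Z i ω ^ 2 - Var[Z i; P] with hW
  have hWm : ∀ i, AEMeasurable (W i) P := fun i =>
    ((hZg.eval i).aemeasurable.pow_const 2).sub_const _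
  have hWi : iIndepFun W P := by
    have := hindep.comp₀ (fun i z => z ^ 2 - Var[Z i; P]) (fun i => (hZg.eval i).aemeasurable)
      (fun i => by fun_prop)
    exact this
  have hmgf := hWi.mgf_sum₀ (t := s) hWm Finset.univ
  have hsum : ∀ ω, ∑ i, (X i ω ^ 2 - Var[X i; P]) = (∑ i, W i) ω := by
    intro ω
    simp only [hW, Finset.sum_apply, Finset.sum_sub_distrib, hsq, htr, hZvar]
  have hpos : 0 < mgf (∑ i, W i) P s := by
    rw [hmgf]
    exact Finset.prod_pos fun i _ => mgf_pos (mgf_sq_sub_le (hZg.eval i) (hZ0 i) (hsl i)).1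
  simp only [hsum]
  constructor
  · by_contra hcon
    rw [mgf, integral_undef hcon] at hpos
    exact lt_irrefl _ hpos
  · calc mgf (∑ i, W i) P s ≤ ∏ i, Real.exp (4 * s ^ 2 * Var[Z i; P] ^ 2) := by
          rw [hmgf]
          exact Finset.prod_le_prod (fun i _ => mgf_nonneg) fun i _ =>
            (mgf_sq_sub_le (hZg.eval i) (hZ0 i) (hsl i)).2
      _ = Real.exp (4 * s ^ 2 * ∑ i, l i ^ 2) := by
          rw [← Real.exp_sum, Finset.mul_sum]
          simp only [hZvar]
      _ ≤ Real.exp (1 / 4) := by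
          gcongr
          have h1 : s ^ 2 = (1 / (4 * B)) ^ 2 := by rw [← sq_abs, hs]
          rw [h1]
          calc 4 * (1 / (4 * B)) ^ 2 * ∑ i, l i ^ 2 ≤ 4 * (1 / (4 * B)) ^ 2 * B ^ 2 := by gcongr
            _ = 1 / 4 := by field_simp

/-- Eighth moments of a centred quadratic form in a centred Gaussian vector. -/
theorem lintegral_quadratic_pow_le {Ω' : Type*} [MeasurableSpace Ω'] {P : Measure Ω'}
    [IsProbabilityMeasure P] {ι : Type*} [Fintype ι] {X : ι → Ω' → ℝ}
    (hX : HasGaussianLaw (fun ω => (X · ω)) P) (h0 : ∀ i, ∫ ω, X i ω ∂P = 0) {B : ℝ} (hB : 0 < B)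
    (hcov : ∑ i, ∑ j, cov[X i, X j; P] ^ 2 ≤ B ^ 2) :
    ∫⁻ ω, ENNReal.ofReal ((∑ i, (X i ω ^ 2 - Var[X i; P])) ^ 8) ∂P
      ≤ ENNReal.ofReal (Nat.factorial 8 * (4 * B) ^ 8 * (2 * Real.exp (1 / 4))) := by
  set W : Ω' → ℝ := fun ω => ∑ i, (X i ω ^ 2 - Var[X i; P]) with hW
  set s : ℝ := 1 / (4 * B) with hs
  have hs0 : 0 < s := by positivity
  obtain ⟨hi1, hb1⟩ := integral_exp_quadratic_le hX h0 hB hcov (s := s) (abs_of_pos hs0)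
  obtain ⟨hi2, hb2⟩ := integral_exp_quadratic_le hX h0 hB hcov (s := -s)
    (by rw [abs_neg, abs_of_pos hs0])
  -- From `x ^ 8 / 8! ≤ exp |x| ≤ exp x + exp (-x)` at `x = s W`.
  have hpt : ∀ ω, W ω ^ 8 ≤ Nat.factorial 8 * (4 * B) ^ 8 *
      (Real.exp (s * W ω) + Real.exp (-s * W ω)) := by
    intro ω
    have h1 := Real.pow_div_factorial_le_exp |s * W ω| (abs_nonneg _) 8
    have h2 : Real.exp |s * W ω| ≤ Real.exp (s * W ω) + Real.exp (-s * W ω) := by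
      have := Real.exp_pos (s * W ω)
      have := Real.exp_pos (-s * W ω)
      rcases abs_choice (s * W ω) with h | h <;> rw [h]
      · linarith
      · rw [← neg_mul]; linarith
    rw [div_le_iff₀ (by positivity), Even.pow_abs (by decide)] at h1
    have h3 : W ω ^ 8 = (4 * B) ^ 8 * (s * W ω) ^ 8 := by
      rw [hs, mul_pow]; field_simp
    rw [h3]
    calc (4 * B) ^ 8 * (s * W ω) ^ 8 ≤ (4 * B) ^ 8 * (Real.exp |s * W ω| * (Nat.factorial 8 : ℕ)) := by
          gcongr
      _ ≤ (4 * B) ^ 8 * ((Real.exp (s * W ω) + Real.exp (-s * W ω)) * (Nat.factorial 8 : ℕ)) := by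
          gcongr
      _ = _ := by ring
  have hint : Integrable (fun ω => (Nat.factorial 8 : ℝ) * (4 * B) ^ 8 *
      (Real.exp (s * W ω) + Real.exp (-s * W ω))) P := (hi1.add hi2).const_mul _
  calc ∫⁻ ω, ENNReal.ofReal (W ω ^ 8) ∂P
      ≤ ∫⁻ ω, ENNReal.ofReal (Nat.factorial 8 * (4 * B) ^ 8 *
        (Real.exp (s * W ω) + Real.exp (-s * W ω))) ∂P :=
        lintegral_mono fun ω => ENNReal.ofReal_le_ofReal (hpt ω)
    _ = ENNReal.ofReal (∫ ω, Nat.factorial 8 * (4 * B) ^ 8 *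
        (Real.exp (s * W ω) + Real.exp (-s * W ω)) ∂P) :=
        (ofReal_integral_eq_lintegral_ofReal hint
          (Eventually.of_forall fun ω => by positivity)).symm
    _ ≤ _ := by
        refine ENNReal.ofReal_le_ofReal ?_
        rw [integral_const_mul, integral_add hi1 hi2]
        gcongr
        linarith

/-- Random variables with summable eighth moments tend to zero almost surely. -/
theorem ae_tendsto_zero_of_summable_moments {Ω' : Type*} [MeasurableSpace Ω'] {P : Measure Ω'}
    {W : ℕ → Ω' → ℝ} (hW : ∀ n, AEMeasurable (W n) P) {c : ℕ → ℝ} (hc : Summable c)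
    (hc0 : ∀ n, 0 ≤ c n)
    (hle : ∀ n, ∫⁻ ω, ENNReal.ofReal (W n ω ^ 8) ∂P ≤ ENNReal.ofReal (c n)) :
    ∀ᵐ ω ∂P, Tendsto (fun n => W n ω) atTop (𝓝 0) := by
  have hm : ∀ n, AEMeasurable (fun ω => ENNReal.ofReal (W n ω ^ 8)) P := fun n =>
    ((hW n).pow_const 8).ennreal_ofReal
  -- By Tonelli the series of eighth powers has finite expectation, so it converges almost surely
  -- and its terms tend to `0`.
  have hfin : ∫⁻ ω, ∑' n, ENNReal.ofReal (W n ω ^ 8) ∂P ≠ ⊤ := by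
    rw [lintegral_tsum hm]
    refine ne_top_of_le_ne_top ?_ (ENNReal.tsum_le_tsum hle)
    rw [← ENNReal.ofReal_tsum_of_nonneg hc0 hc]
    exact ENNReal.ofReal_ne_top
  filter_upwards [ae_lt_top' (AEMeasurable.tsum hm) hfin] with ω hω
  have h1 := ENNReal.tendsto_atTop_zero_of_tsum_ne_top hω.ne
  have h2 : Tendsto (fun n => W n ω ^ 8) atTop (𝓝 0) := by
    have h3 := (ENNReal.tendsto_toReal ENNReal.zero_ne_top).comp h1
    simp only [ENNReal.toReal_zero] at h3
    refine h3.congr fun n => ?_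
    exact ENNReal.toReal_ofReal (Even.pow_nonneg (by decide) _)
  have h4 : Tendsto (fun n => (W n ω ^ 8) ^ ((1 : ℝ) / 8)) atTop (𝓝 (0 ^ ((1 : ℝ) / 8))) :=
    ((Real.continuous_rpow_const (by norm_num)).tendsto 0).comp h2
  rw [Real.zero_rpow (by norm_num)] at h4
  rw [tendsto_zero_iff_abs_tendsto_zero]
  refine h4.congr fun n => ?_
  rw [Function.comp_apply, ← Even.pow_abs (by decide), ← Real.rpow_natCast,
    ← Real.rpow_mul (abs_nonneg _)]
  norm_num

/-! ### Lattice sums and grid counts -/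

/-- Bernoulli's inequality for the exponent `1 - θ` bounds each new term by the increment of `N ^ (1
- θ) / (1 - θ)`. -/
theorem sum_range_add_one_rpow_neg_le {θ : ℝ} (h0 : 0 ≤ θ) (h1 : θ < 1) (N : ℕ) :
    ∑ k ∈ Finset.range N, ((k : ℝ) + 1) ^ (-θ) ≤ (N : ℝ) ^ (1 - θ) / (1 - θ) := by
  have hθ : 0 < 1 - θ := by linarith
  induction N with
  | zero => simp [Real.zero_rpow hθ.ne']
  | succ N ih =>
    rw [Finset.sum_range_succ]
    have hN : (0 : ℝ) < (N : ℝ) + 1 := by positivity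
    have h2 := rpow_one_add_le_one_add_mul_self (s := -(1 / ((N : ℝ) + 1)))
      (by rw [neg_le_neg_iff, div_le_one hN]; linarith [(N.cast_nonneg : (0 : ℝ) ≤ N)])
      hθ.le (by linarith)
    have h3 : 1 + -(1 / ((N : ℝ) + 1)) = N / (N + 1) := by field_simp; ring
    rw [h3, Real.div_rpow N.cast_nonneg hN.le, div_le_iff₀ (by positivity)] at h2
    have h4 : ((N : ℝ) + 1) ^ (1 - θ) = ((N : ℝ) + 1) * ((N : ℝ) + 1) ^ (-θ) := by
      rw [sub_eq_add_neg, Real.rpow_add hN, Real.rpow_one]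
    have h5 : (1 + (1 - θ) * -(1 / ((N : ℝ) + 1))) * ((N : ℝ) + 1) ^ (1 - θ)
        = ((N : ℝ) + 1) ^ (1 - θ) - (1 - θ) * ((N : ℝ) + 1) ^ (-θ) := by
      rw [h4]; field_simp
      ring
    rw [h5] at h2
    push_cast
    calc _ ≤ (N : ℝ) ^ (1 - θ) / (1 - θ) + ((N : ℝ) + 1) ^ (-θ) := by gcongr
      _ ≤ _ := by
        rw [div_add' _ _ _ hθ.ne']
        gcongr
        linarith

theorem sum_Icc_one_add_abs_rpow_neg_le {θ : ℝ} (h0 : 0 ≤ θ) (h1 : θ < 1) (T : ℕ) :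
    ∑ z ∈ Finset.Icc (-(T : ℤ)) T, (1 + |(z : ℝ)|) ^ (-θ)
      ≤ 2 / (1 - θ) * ((T : ℝ) + 1) ^ (1 - θ) := by
  have hθ : 0 < 1 - θ := by linarith
  have hsub : Finset.Icc (-(T : ℤ)) T ⊆
      (Finset.range (T + 1)).image (fun k : ℕ => (k : ℤ)) ∪
        (Finset.range (T + 1)).image (fun k : ℕ => -(k : ℤ)) := by
    intro z hz
    rw [Finset.mem_Icc] at hz
    rw [Finset.mem_union, Finset.mem_image, Finset.mem_image]
    rcases le_total 0 z with h | h
    · exact Or.inl ⟨z.toNat, by rw [Finset.mem_range]; omega, by omega⟩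
    · exact Or.inr ⟨(-z).toNat, by rw [Finset.mem_range]; omega, by omega⟩
  have h2 := sum_range_add_one_rpow_neg_le h0 h1 (T + 1)
  calc _ ≤ ∑ z ∈ (Finset.range (T + 1)).image (fun k : ℕ => (k : ℤ)) ∪
        (Finset.range (T + 1)).image (fun k : ℕ => -(k : ℤ)), (1 + |(z : ℝ)|) ^ (-θ) :=
        Finset.sum_le_sum_of_subset_of_nonneg hsub fun _ _ _ => by positivity
    _ ≤ ∑ z ∈ (Finset.range (T + 1)).image (fun k : ℕ => (k : ℤ)), (1 + |(z : ℝ)|) ^ (-θ)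
        + ∑ z ∈ (Finset.range (T + 1)).image (fun k : ℕ => -(k : ℤ)), (1 + |(z : ℝ)|) ^ (-θ) := by
        rw [← Finset.sum_union_inter]
        exact le_add_of_nonneg_right (Finset.sum_nonneg fun _ _ => by positivity)
    _ = 2 * ∑ k ∈ Finset.range (T + 1), ((k : ℝ) + 1) ^ (-θ) := by
        rw [Finset.sum_image (fun a _ b _ h => by simpa using h),
          Finset.sum_image (fun a _ b _ h => by simpa using h), two_mul]
        simp [add_comm]
    _ ≤ 2 * (((T + 1 : ℕ) : ℝ) ^ (1 - θ) / (1 - θ)) := by gcongr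
    _ = _ := by push_cast; ring

section Grid

variable {d : ℕ} {Ω : Set (EuclideanSpace ℝ (Fin d))}

theorem exists_abs_apply_le_of_isBounded (hΩ : Bornology.IsBounded Ω) :
    ∃ R : ℝ, 0 ≤ R ∧ ∀ x ∈ Ω, ∀ i, |x i| ≤ R := by
  obtain ⟨R, hR⟩ := hΩ.exists_norm_le
  refine ⟨max R 0, le_max_right _ _, fun x hx i => ?_⟩
  rw [← Real.norm_eq_abs]
  exact (PiLp.norm_apply_le x i).trans ((hR x hx).trans (le_max_left _ _))

theorem finite_gridPoints (hΩ : Bornology.IsBounded Ω) {n : ℕ} (hn : 0 < n) :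
    (gridPoints Ω n).Finite := by
  obtain ⟨R, -, hR⟩ := exists_abs_apply_le_of_isBounded hΩ
  have hn' : (0 : ℝ) < n := by exact_mod_cast hn
  refine Set.Finite.subset ((Finset.finite_toSet (Fintype.piFinset fun _ : Fin d =>
    Finset.Icc (-⌈R * n⌉) ⌈R * n⌉)).image
      (fun z : Fin d → ℤ => WithLp.toLp 2 fun i => (z i : ℝ) / n)) ?_
  rintro x ⟨hx, z, hz⟩
  refine ⟨z, ?_, by ext i; simp [hz]⟩
  rw [Finset.mem_coe, Fintype.mem_piFinset]
  intro i
  have h1 := hR x hx i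
  rw [hz, abs_div, abs_of_pos hn', div_le_iff₀ hn'] at h1
  obtain ⟨h2, h3⟩ := abs_le.1 h1
  have h4 := Int.le_ceil (R * n)
  rw [Finset.mem_Icc]
  constructor
  · have : ((-⌈R * n⌉ : ℤ) : ℝ) ≤ z i := by push_cast; linarith
    exact_mod_cast this
  · have : (z i : ℝ) ≤ (⌈R * n⌉ : ℤ) := by linarith
    exact_mod_cast this

theorem exists_le_ncard_gridPoints (hΩo : IsOpen Ω) (hΩ : Bornology.IsBounded Ω)
    (hne : Ω.Nonempty) :
    ∃ c : ℝ, 0 < c ∧ ∀ᶠ n : ℕ in atTop, c * (n : ℝ) ^ d ≤ ((gridPoints Ω n).ncard : ℝ) := by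
  obtain ⟨x₀, hx₀⟩ := hne
  -- Balls of the sup norm are cubes, so `Ω` contains a cube, in which grid points are counted one
  -- coordinate at a time.
  have hpre : IsOpen ((fun y : Fin d → ℝ => (WithLp.toLp 2 y : EuclideanSpace ℝ (Fin d))) ⁻¹' Ω) :=
    hΩo.preimage (PiLp.continuous_toLp 2 _)
  obtain ⟨δ, hδ, hball⟩ := Metric.isOpen_iff.1 hpre x₀.ofLp (by simpa using hx₀)
  refine ⟨(δ / 4) ^ d, by positivity, ?_⟩
  filter_upwards [eventually_gt_atTop 0, eventually_ge_atTop ⌈4 / δ⌉₊] with n hn hn2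
  have hn' : (0 : ℝ) < n := by exact_mod_cast hn
  have hn3 : 4 / δ ≤ n := Nat.ceil_le.1 hn2
  rw [div_le_iff₀ hδ] at hn3
  -- Since `δ n ≥ 4`, rounding down still leaves `L ≥ δ n / 4`, and the offsets from `n x₀`, which
  -- lie between `-1` and `L`, stay inside the cube.
  set L : ℕ := ⌊δ / 2 * n⌋₊ with hL
  have hL1 : (L : ℝ) ≤ δ / 2 * n := Nat.floor_le (by positivity)
  have hL2 : δ / 4 * n ≤ L := by
    have := Nat.lt_floor_add_one (δ / 2 * n)
    rw [← hL] at this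
    nlinarith
  let φ : (Fin d → Fin L) → EuclideanSpace ℝ (Fin d) := fun k =>
    WithLp.toLp 2 fun i => ((⌊n * x₀ i⌋ + (k i : ℕ) : ℤ) : ℝ) / n
  have hφ : ∀ k, φ k ∈ gridPoints Ω n := by
    intro k
    refine ⟨hball ?_, fun i => ⌊n * x₀ i⌋ + (k i : ℕ), fun i => rfl⟩
    rw [Metric.mem_ball, dist_pi_lt_iff hδ]
    intro i
    rw [Real.dist_eq, abs_lt]
    have h1 := Int.floor_le (n * x₀ i)
    have h2 := Int.lt_floor_add_one (n * x₀ i)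
    have h3 : (((k i : ℕ) : ℝ)) + 1 ≤ L := by exact_mod_cast (k i).2
    have h0 : (0 : ℝ) ≤ ((k i : ℕ) : ℝ) := Nat.cast_nonneg _
    push_cast
    rw [div_sub' hn'.ne', lt_div_iff₀ hn', div_lt_iff₀ hn']
    constructor <;> nlinarith
  have hinj : Function.Injective φ := by
    intro k l hkl
    ext i
    have h1 : (φ k) i = (φ l) i := by rw [hkl]
    have h2 : ((⌊n * x₀ i⌋ + (k i : ℕ) : ℤ) : ℝ) / n = ((⌊n * x₀ i⌋ + (l i : ℕ) : ℤ) : ℝ) / n := h1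
    rw [div_left_inj' hn'.ne', Int.cast_inj] at h2
    omega
  have hcard : L ^ d ≤ (gridPoints Ω n).ncard := by
    have h1 : (Set.range φ).ncard = L ^ d := by
      rw [← Set.image_univ, Set.ncard_image_of_injective _ hinj, Set.ncard_univ]
      simp
    rw [← h1]
    exact Set.ncard_le_ncard (Set.range_subset_iff.2 hφ) (finite_gridPoints hΩ hn)
  calc (δ / 4) ^ d * (n : ℝ) ^ d = (δ / 4 * n) ^ d := by rw [mul_pow]
    _ ≤ (L : ℝ) ^ d := by gcongr
    _ ≤ _ := by exact_mod_cast hcard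

/-- The norm dominates every coordinate, so the summand is at most a product of `d` one-dimensional
factors with exponent `θ = τ / d < 1`. The sum over a box is then the `d`-th power of a sum of order
`n ^ (1 - θ)`. -/
theorem exists_sum_gridPoints_rpow_le (hΩ : Bornology.IsBounded Ω) {τ : ℝ} (hτ : 0 ≤ τ)
    (hd : τ < d) :
    ∃ C : ℝ, 0 ≤ C ∧ ∀ (n : ℕ) (hn : 0 < n), ∀ x ∈ gridPoints Ω n,
      ∑ y ∈ (finite_gridPoints hΩ hn).toFinset, (1 + n * ‖x - y‖) ^ (-τ)
        ≤ C * (n : ℝ) ^ ((d : ℝ) - τ) := by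
  obtain ⟨R, hR0, hR⟩ := exists_abs_apply_le_of_isBounded hΩ
  have hd0 : (0 : ℝ) < d := by linarith
  set θ : ℝ := τ / d with hθ
  have hθ0 : 0 ≤ θ := by positivity
  have hθ1 : θ < 1 := by rw [hθ, div_lt_one hd0]; exact hd
  have hθ2 : 0 < 1 - θ := by linarith
  have hθd : θ * d = τ := by rw [hθ]; field_simp
  refine ⟨(2 / (1 - θ) * (2 * R + 2) ^ (1 - θ)) ^ d, by positivity, fun n hn x hx => ?_⟩
  have hn' : (0 : ℝ) < n := by exact_mod_cast hn
  have hn1 : (1 : ℝ) ≤ n := by exact_mod_cast hn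
  obtain ⟨hxΩ, a, ha⟩ := hx
  set T : ℕ := ⌊2 * R * n⌋₊ with hT
  have hT1 : (T : ℝ) ≤ 2 * R * n := Nat.floor_le (by positivity)
  -- Rounding recovers the integer coordinates of a grid point, so the label is the integer lag `n
  -- (x - y)`.
  set lab : EuclideanSpace ℝ (Fin d) → Fin d → ℤ := fun y i => a i - round (n * y i) with hlab
  have hlabel : ∀ y ∈ gridPoints Ω n, ∀ i, (lab y i : ℝ) = n * (x i - y i) := by
    rintro y ⟨-, b, hb⟩ i
    have h1 : (n : ℝ) * y i = b i := by rw [hb]; field_simp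
    simp only [hlab]
    rw [h1, round_intCast, mul_sub, h1, ha]
    push_cast
    field_simp
  have hpt : ∀ y ∈ gridPoints Ω n,
      (1 + n * ‖x - y‖) ^ (-τ) ≤ ∏ i, (1 + |(lab y i : ℝ)|) ^ (-θ) := by
    intro y hy
    have h1 : (1 + n * ‖x - y‖) ^ (-τ) = ∏ _i : Fin d, (1 + n * ‖x - y‖) ^ (-θ) := by
      rw [Finset.prod_const, Finset.card_univ, Fintype.card_fin, ← Real.rpow_natCast,
        ← Real.rpow_mul (by positivity), neg_mul, hθd]
    rw [h1]
    refine Finset.prod_le_prod (fun i _ => by positivity) fun i _ => ?_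
    refine Real.rpow_le_rpow_of_nonpos (by positivity) ?_ (by linarith)
    rw [hlabel y hy, abs_mul, abs_of_pos hn']
    gcongr
    have := PiLp.norm_apply_le (x - y) i
    rwa [Real.norm_eq_abs] at this
  have hmap : ∀ y ∈ gridPoints Ω n,
      lab y ∈ Fintype.piFinset fun _ : Fin d => Finset.Icc (-(T : ℤ)) T := by
    intro y hy
    rw [Fintype.mem_piFinset]
    intro i
    have h1 : |(lab y i : ℝ)| ≤ 2 * R * n := by
      rw [hlabel y hy, abs_mul, abs_of_pos hn', mul_comm]
      gcongr
      have h2 := hR x hxΩ i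
      have h3 := hR y hy.1 i
      have := abs_sub (x i) (y i)
      linarith
    have h2 : ((lab y i).natAbs : ℝ) ≤ 2 * R * n := by
      rw [Nat.cast_natAbs, Int.cast_abs]; exact h1
    have h3 : (lab y i).natAbs ≤ T := Nat.le_floor h2
    rw [Finset.mem_Icc]
    omega
  have hinj : Set.InjOn lab ((finite_gridPoints hΩ hn).toFinset : Set _) := by
    intro y hy z hz hyz
    rw [Set.Finite.coe_toFinset] at hy hz
    ext i
    have h1 := hlabel y hy i
    rw [hyz, hlabel z hz i] at h1
    have := mul_left_cancel₀ hn'.ne' h1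
    linarith
  calc _ ≤ ∑ y ∈ (finite_gridPoints hΩ hn).toFinset, ∏ i, (1 + |(lab y i : ℝ)|) ^ (-θ) :=
        Finset.sum_le_sum fun y hy => hpt y ((Set.Finite.mem_toFinset _).1 hy)
    _ = ∑ z ∈ (finite_gridPoints hΩ hn).toFinset.image lab, ∏ i, (1 + |(z i : ℝ)|) ^ (-θ) := by
        rw [Finset.sum_image hinj]
    _ ≤ ∑ z ∈ Fintype.piFinset fun _ : Fin d => Finset.Icc (-(T : ℤ)) T,
          ∏ i, (1 + |(z i : ℝ)|) ^ (-θ) := by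
        refine Finset.sum_le_sum_of_subset_of_nonneg ?_ fun _ _ _ =>
          Finset.prod_nonneg fun _ _ => by positivity
        intro z hz
        obtain ⟨y, hy, rfl⟩ := Finset.mem_image.1 hz
        exact hmap y ((Set.Finite.mem_toFinset _).1 hy)
    _ = (∑ z ∈ Finset.Icc (-(T : ℤ)) T, (1 + |(z : ℝ)|) ^ (-θ)) ^ d := by
        have := Finset.prod_univ_sum (fun _ : Fin d => Finset.Icc (-(T : ℤ)) T)
          (fun _ z => (1 + |(z : ℝ)|) ^ (-θ))
        rw [← this, Finset.prod_const, Finset.card_univ, Fintype.card_fin]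
    _ ≤ (2 / (1 - θ) * ((T : ℝ) + 1) ^ (1 - θ)) ^ d := by
        gcongr
        exact sum_Icc_one_add_abs_rpow_neg_le hθ0 hθ1 T
    _ ≤ (2 / (1 - θ) * ((2 * R + 2) * n) ^ (1 - θ)) ^ d := by
        gcongr
        nlinarith
    _ = (2 / (1 - θ) * (2 * R + 2) ^ (1 - θ)) ^ d * (n : ℝ) ^ ((d : ℝ) - τ) := by
        rw [Real.mul_rpow (by positivity) hn'.le, ← mul_assoc, mul_pow _ ((n : ℝ) ^ (1 - θ)),
          ← Real.rpow_natCast ((n : ℝ) ^ (1 - θ)), ← Real.rpow_mul hn'.le, sub_mul, one_mul, hθd]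

end Grid

/-! ### Increments of the field and their covariances -/

theorem exists_le_norm_toEuclideanLin {d : ℕ} {M : Matrix (Fin d) (Fin d) ℝ} (hM : M.det = 1) :
    ∃ c : ℝ, 0 < c ∧ ∀ x, c * ‖x‖ ≤ ‖Matrix.toEuclideanLin M x‖ := by
  have hinj : Function.Injective (Matrix.toEuclideanLin M) := by
    have h1 : Function.Injective M.mulVec :=
      Matrix.mulVec_injective_iff_isUnit.2 ((Matrix.isUnit_iff_isUnit_det M).2 (by simp [hM]))
    intro x y hxy
    exact WithLp.ofLp_injective 2 (h1 (congrArg WithLp.ofLp hxy))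
  obtain ⟨K, hK, hL⟩ := (Matrix.toEuclideanLin M).exists_antilipschitzWith
    (LinearMap.ker_eq_bot.2 hinj)
  refine ⟨(K : ℝ)⁻¹, by positivity, fun x => ?_⟩
  have := hL.le_mul_dist x 0
  rw [map_zero, dist_zero_right, dist_zero_right] at this
  rw [inv_mul_le_iff₀ (by exact_mod_cast hK)]
  exact this

section Increments

variable {d : ℕ} {S : Type*} {σ α ν : ℝ}
  {M : Matrix (Fin d) (Fin d) ℝ} {D : Set (EuclideanSpace ℝ (Fin d))}
  {Y : EuclideanSpace ℝ (Fin d) → S → ℝ} {h : EuclideanSpace ℝ (Fin d)} {m n : ℕ}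

/-- The increment of order `m` in the direction `h / n`, scaled by `n ^ ν`. -/
noncomputable def scaledIncrement (ν : ℝ) (h : EuclideanSpace ℝ (Fin d)) (m n : ℕ)
    (Y : EuclideanSpace ℝ (Fin d) → S → ℝ) (x : EuclideanSpace ℝ (Fin d)) (ω : S) : ℝ :=
  ∑ k : Fin (m + 1), ((n : ℝ) ^ ν * ((-1) ^ (m - (k : ℕ)) * (m.choose k : ℝ))) *
    Y (x + ((k : ℕ) / (n : ℝ)) • h) ω

theorem scaledIncrement_eq_fwdDiff (x : EuclideanSpace ℝ (Fin d)) (ω : S) :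
    scaledIncrement ν h m n Y x ω
      = (n : ℝ) ^ ν * (fwdDiff ((n : ℝ)⁻¹ • h))^[m] (fun t => Y t ω) x := by
  rw [fwdDiff_iter_eq_sum_shift, scaledIncrement, Finset.mul_sum,
    Fin.sum_univ_eq_sum_range (fun k => ((n : ℝ) ^ ν * ((-1) ^ (m - k) * (m.choose k : ℝ))) *
      Y (x + ((k : ℝ) / (n : ℝ)) • h) ω)]
  refine Finset.sum_congr rfl fun k _ => ?_
  rw [zsmul_eq_mul, ← Nat.cast_smul_eq_nsmul ℝ, smul_smul, ← div_eq_mul_inv]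
  push_cast
  ring

theorem quadVar_eq_sum_scaledIncrement {Ω : Set (EuclideanSpace ℝ (Fin d))} {G : Finset (EuclideanSpace ℝ (Fin d))}
    (hG : (G : Set _) = gridPoints Ω n) (ω : S) :
    quadVar ν Ω h m n (fun t => Y t ω)
      = 1 / (G.card : ℝ) * ∑ x : G, scaledIncrement ν h m n Y x ω ^ 2 := by
  rw [quadVar, ← hG, finsum_mem_coe_finset, Set.ncard_coe_finset,
    Finset.sum_coe_sort G (fun x => scaledIncrement ν h m n Y x ω ^ 2)]
  congr 1
  refine Finset.sum_congr rfl fun x _ => ?_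
  rw [scaledIncrement_eq_fwdDiff, mul_pow, ← Real.rpow_natCast ((n : ℝ) ^ ν),
    ← Real.rpow_mul n.cast_nonneg, Nat.cast_ofNat, mul_comm ν]

variable [MeasurableSpace S] {P : Measure S}

theorem IsMaternField.hasGaussianLaw (hY : IsMaternField P σ α ν M D Y) {t : EuclideanSpace ℝ (Fin d)} (ht : t ∈ D) :
    HasGaussianLaw (Y t) P :=
  hY.gaussian.hasGaussianLaw_eval ⟨t, ht⟩

theorem hasGaussianLaw_scaledIncrement (hY : IsMaternField P σ α ν M D Y)
    {G : Finset (EuclideanSpace ℝ (Fin d))}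
    (hG : ∀ x ∈ G, ∀ k ≤ m, x + ((k : ℝ) / (n : ℝ)) • h ∈ D) :
    HasGaussianLaw (fun ω => fun x : G => scaledIncrement ν h m n Y x ω) P := by
  classical
  let pt : G × Fin (m + 1) → D := fun a =>
    ⟨(a.1 : EuclideanSpace ℝ (Fin d)) + (((a.2 : ℕ) : ℝ) / (n : ℝ)) • h,
      hG a.1 a.1.2 a.2 (Nat.lt_succ_iff.1 a.2.2)⟩
  -- Increments at different grid points may use the same value of the field. The increments are
  -- therefore a linear image of the field on the finite set of distinct points.
  let I : Finset D := Finset.univ.image pt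
  have hmem : ∀ a, pt a ∈ I := fun a => Finset.mem_image_of_mem pt (Finset.mem_univ a)
  let L : (I → ℝ) →L[ℝ] (G → ℝ) := ContinuousLinearMap.pi fun x => ∑ k : Fin (m + 1),
    ((n : ℝ) ^ ν * ((-1) ^ (m - (k : ℕ)) * (m.choose k : ℝ))) •
      (ContinuousLinearMap.proj (⟨pt (x, k), hmem _⟩ : I) : (I → ℝ) →L[ℝ] ℝ)
  refine ((hY.gaussian.hasGaussianLaw I).map_fun L).congr (Eventually.of_forall fun ω => ?_)
  ext x
  simp [L, scaledIncrement, pt, Finset.restrict_def]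

theorem integral_scaledIncrement (hY : IsMaternField P σ α ν M D Y)
    {x : EuclideanSpace ℝ (Fin d)}
    (hx : ∀ k ≤ m, x + ((k : ℝ) / (n : ℝ)) • h ∈ D) :
    ∫ ω, scaledIncrement ν h m n Y x ω ∂P = 0 := by
  have hk : ∀ k : Fin (m + 1), x + (((k : ℕ) : ℝ) / (n : ℝ)) • h ∈ D := fun k =>
    hx k (Nat.lt_succ_iff.1 k.2)
  simp only [scaledIncrement]
  rw [integral_finsetSum _ fun k _ => ((hY.hasGaussianLaw (hk k)).integrable).const_mul _]
  simp [integral_const_mul, hY.mean_zero _ (hk _)]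

/-- Factoring out `|M h| / n` leaves a unit direction and the rescaled lag `(n / |M h|) M (x - y)`,
the form required by the decay estimate. -/
theorem covariance_scaledIncrement (hY : IsMaternField P σ α ν M D Y)
    (hn : 0 < n) (hr : 0 < ‖Matrix.toEuclideanLin M h‖)
    {x y : EuclideanSpace ℝ (Fin d)}
    (hx : ∀ k ≤ m, x + ((k : ℝ) / (n : ℝ)) • h ∈ D)
    (hy : ∀ k ≤ m, y + ((k : ℝ) / (n : ℝ)) • h ∈ D) :
    cov[scaledIncrement ν h m n Y x, scaledIncrement ν h m n Y y; P]
      = (n : ℝ) ^ (2 * ν) * altSum m (fun s => maternCov σ α ν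
        (‖Matrix.toEuclideanLin M h‖ / n *
          ‖(n / ‖Matrix.toEuclideanLin M h‖) • Matrix.toEuclideanLin M (x - y)
            + s • (‖Matrix.toEuclideanLin M h‖⁻¹ • Matrix.toEuclideanLin M h)‖)) := by
  have hP : IsProbabilityMeasure P := hY.gaussian.isProbabilityMeasure
  have hn' : (0 : ℝ) < n := by exact_mod_cast hn
  set r := ‖Matrix.toEuclideanLin M h‖ with hrdef
  have hkx : ∀ k : Fin (m + 1), x + (((k : ℕ) : ℝ) / (n : ℝ)) • h ∈ D := fun k =>
    hx k (Nat.lt_succ_iff.1 k.2)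
  have hky : ∀ k : Fin (m + 1), y + (((k : ℕ) : ℝ) / (n : ℝ)) • h ∈ D := fun k =>
    hy k (Nat.lt_succ_iff.1 k.2)
  have h2ν : (n : ℝ) ^ (2 * ν) = (n : ℝ) ^ ν * (n : ℝ) ^ ν := by
    rw [← Real.rpow_add hn', two_mul]
  unfold scaledIncrement
  rw [covariance_fun_sum_fun_sum
    (fun k => ((hY.hasGaussianLaw (hkx k)).memLp_two).const_mul _)
    (fun k => ((hY.hasGaussianLaw (hky k)).memLp_two).const_mul _)]
  simp only [covariance_const_mul_left, covariance_const_mul_right, hY.cov_eq _ (hkx _) _ (hky _)]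
  rw [altSum, Finset.mul_sum, Finset.sum_range]
  refine Finset.sum_congr rfl fun i _ => ?_
  rw [Finset.mul_sum, Finset.sum_range]
  refine Finset.sum_congr rfl fun j _ => ?_
  have hnorm : ‖Matrix.toEuclideanLin M (x + (((i : ℕ) : ℝ) / (n : ℝ)) • h)
      - Matrix.toEuclideanLin M (y + (((j : ℕ) : ℝ) / (n : ℝ)) • h)‖
      = r / n * ‖(n / r) • Matrix.toEuclideanLin M (x - y)
            + (((i : ℕ) : ℝ) - ((j : ℕ) : ℝ)) • (r⁻¹ • Matrix.toEuclideanLin M h)‖ := by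
    have hpos : 0 < r / n := div_pos hr hn'
    rw [← abs_of_pos hpos, ← Real.norm_eq_abs, ← norm_smul]
    congr 1
    rw [map_add, map_add, map_sub, map_smul, map_smul, smul_add, smul_smul, smul_smul, smul_smul,
      show r / n * (n / r) = 1 by field_simp,
      show r / n * (((i : ℕ) : ℝ) - ((j : ℕ) : ℝ)) * r⁻¹
        = ((i : ℕ) : ℝ) / n - ((j : ℕ) : ℝ) / n by field_simp]
    module
  rw [hnorm, h2ν, neg_one_pow_sub_eq (Nat.lt_succ_iff.1 i.2),
    neg_one_pow_sub_eq (Nat.lt_succ_iff.1 j.2), pow_add]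
  have hsq : ((-1 : ℝ) ^ m) * (-1) ^ m = 1 := by rw [← mul_pow]; simp
  linear_combination ((n : ℝ) ^ ν * (n : ℝ) ^ ν * (-1) ^ (i : ℕ) * (-1) ^ (j : ℕ)
    * (m.choose i : ℝ) * (m.choose j : ℝ) * maternCov σ α ν
      (r / n * ‖(n / r) • Matrix.toEuclideanLin M (x - y)
            + (((i : ℕ) : ℝ) - ((j : ℕ) : ℝ)) • (r⁻¹ • Matrix.toEuclideanLin M h)‖)) * hsq

theorem variance_scaledIncrement (hY : IsMaternField P σ α ν M D Y)
    (hn : 0 < n) (hr : 0 < ‖Matrix.toEuclideanLin M h‖)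
    {x : EuclideanSpace ℝ (Fin d)} (hx : ∀ k ≤ m, x + ((k : ℝ) / (n : ℝ)) • h ∈ D) :
    Var[scaledIncrement ν h m n Y x; P] = (n : ℝ) ^ (2 * ν) * altSum m (fun s => maternCov σ α ν
        (‖Matrix.toEuclideanLin M h‖ / n * |s|)) := by
  have hm := (hasGaussianLaw_scaledIncrement hY (G := {x}) (m := m) (n := n) (h := h)
    (by simpa using hx)).eval ⟨x, by simp⟩
  rw [← covariance_self hm.aemeasurable]
  refine (covariance_scaledIncrement hY hn hr hx hx).trans ?_
  congr 2
  funext s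
  rw [sub_self, map_zero, smul_zero, zero_add, norm_smul, norm_smul, norm_inv, norm_norm,
    inv_mul_cancel₀ hr.ne', mul_one, Real.norm_eq_abs]

end Increments

/-! ### Almost sure convergence -/

/-- Strong law for the quadratic variation, at the rate `n ^ 2`. -/
theorem ae_tendsto_sq_mul_quadVar_sub {d : ℕ} {S : Type*} [MeasurableSpace S] {P : Measure S}
    {σ α ν : ℝ} (hα : 0 < α) (hν : 0 < ν) {M : Matrix (Fin d) (Fin d) ℝ} (hM : M.det = 1)
    {Ω : Set (EuclideanSpace ℝ (Fin d))} (hΩo : IsOpen Ω) (hΩb : Bornology.IsBounded Ω)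
    (hΩne : Ω.Nonempty) {h : EuclideanSpace ℝ (Fin d)} (hh : h ≠ 0) {m : ℕ} (hm : ν + 2 < m)
    (hd : 4 < d) {D : Set (EuclideanSpace ℝ (Fin d))}
    (hD : ∀ᶠ n : ℕ in atTop, ∀ x ∈ gridPoints Ω n, ∀ k ≤ m, x + ((k : ℝ) / (n : ℝ)) • h ∈ D)
    {Y : EuclideanSpace ℝ (Fin d) → S → ℝ} (hY : IsMaternField P σ α ν M D Y) :
    ∀ᵐ ω ∂P, Tendsto (fun n : ℕ => (n : ℝ) ^ 2 * (quadVar ν Ω h m n (fun t => Y t ω)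
      - (n : ℝ) ^ (2 * ν) * altSum m (fun s => maternCov σ α ν
        (‖Matrix.toEuclideanLin M h‖ / n * |s|)))) atTop (𝓝 0) := by
  have hP : IsProbabilityMeasure P := hY.gaussian.isProbabilityMeasure
  have hd5 : (5 : ℝ) ≤ d := by exact_mod_cast hd
  obtain ⟨c₀, hc₀, hlow⟩ := exists_le_norm_toEuclideanLin hM
  set r := ‖Matrix.toEuclideanLin M h‖ with hrdef
  have hr : 0 < r := (mul_pos hc₀ (norm_pos_iff.2 hh)).trans_le (hlow h)
  -- The choice `κ = 9 / 4` needs only `ν + 9 / 8 < m`. The squared decay exponent `9 / 2` exceeds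
  -- `4`, which beats the factor `n⁴`, and is below `5 ≤ d`, as the lattice sum requires.
  obtain ⟨C, hC0, hC⟩ := exists_abs_altSum_matern_le (E := EuclideanSpace ℝ (Fin d)) (σ := σ)
    hα hν hr (m := m) (κ := 9 / 4) (by norm_num) (by linarith)
  obtain ⟨C₂, hC₂0, hC₂⟩ := exists_sum_gridPoints_rpow_le hΩb (τ := 9 / 2) (by norm_num)
    (by linarith)
  obtain ⟨c, hc, hcard⟩ := exists_le_ncard_gridPoints hΩo hΩb hΩne
  set c₁ : ℝ := min 1 (c₀ / r)
  have hc₁ : 0 < c₁ := lt_min one_pos (div_pos hc₀ hr)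
  -- The added `1` keeps `A`, and hence the bound `B` of the moment estimate, strictly positive.
  set A : ℝ := C ^ 2 * c₁ ^ (-(9 / 2) : ℝ) * C₂ + 1 with hA
  have hA0 : 0 < A := by positivity
  obtain ⟨n₀, hn₀⟩ := eventually_atTop.1 ((hD.and hcard).and (eventually_gt_atTop 0))
  set K : ℝ := Nat.factorial 8 * 4 ^ 8 * (2 * Real.exp (1 / 4)) with hK
  suffices hmain : ∀ n ≥ n₀,
      AEMeasurable (fun ω => (n : ℝ) ^ 2 * (quadVar ν Ω h m n (fun t => Y t ω)
        - (n : ℝ) ^ (2 * ν) * altSum m (fun s => maternCov σ α ν (r / n * |s|)))) P ∧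
      ∫⁻ ω, ENNReal.ofReal (((n : ℝ) ^ 2 * (quadVar ν Ω h m n (fun t => Y t ω)
        - (n : ℝ) ^ (2 * ν) * altSum m (fun s => maternCov σ α ν (r / n * |s|)))) ^ 8) ∂P
        ≤ ENNReal.ofReal (K * (A / c) ^ 4 * (1 / (n : ℝ) ^ 2)) by
    have hsum : Summable fun n : ℕ => K * (A / c) ^ 4 * (1 / ((n + n₀ : ℕ) : ℝ) ^ 2) :=
      ((summable_nat_add_iff n₀).2 (Real.summable_one_div_nat_pow.2 one_lt_two)).mul_left _
    have := ae_tendsto_zero_of_summable_moments (P := P)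
      (fun n => (hmain (n + n₀) (by omega)).1) hsum (fun n => by positivity)
      (fun n => (hmain (n + n₀) (by omega)).2)
    filter_upwards [this] with ω hω
    exact (tendsto_add_atTop_iff_nat n₀).1 hω
  intro n hn
  obtain ⟨⟨hDn, hcardn⟩, hnpos⟩ := hn₀ n hn
  have hn' : (0 : ℝ) < n := by exact_mod_cast hnpos
  set G := (finite_gridPoints hΩb hnpos).toFinset with hG
  have hGc : (G : Set (EuclideanSpace ℝ (Fin d))) = gridPoints Ω n := Set.Finite.coe_toFinset _
  have hGmem : ∀ x ∈ G, x ∈ gridPoints Ω n := fun x hx => (Set.Finite.mem_toFinset _).1 hx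
  have hGD : ∀ x ∈ G, ∀ k ≤ m, x + ((k : ℝ) / (n : ℝ)) • h ∈ D := fun x hx =>
    hDn x (hGmem x hx)
  set N : ℝ := (G.card : ℝ) with hN
  have hNlow : c * (n : ℝ) ^ d ≤ N := by
    rw [hN, ← Set.ncard_coe_finset, hGc]; exact hcardn
  have hN0 : 0 < N := lt_of_lt_of_le (by positivity) hNlow
  have hgauss := hasGaussianLaw_scaledIncrement hY hGD
  have hvar : ∀ x : G, Var[scaledIncrement ν h m n Y x; P]
      = (n : ℝ) ^ (2 * ν) * altSum m (fun s => maternCov σ α ν (r / n * |s|)) := fun x =>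
    variance_scaledIncrement hY hnpos hr (hGD x x.2)
  have hQ : ∀ ω, (n : ℝ) ^ 2 * (quadVar ν Ω h m n (fun t => Y t ω)
        - (n : ℝ) ^ (2 * ν) * altSum m (fun s => maternCov σ α ν (r / n * |s|)))
      = (n : ℝ) ^ 2 / N * ∑ x : G, (scaledIncrement ν h m n Y x ω ^ 2
        - Var[scaledIncrement ν h m n Y x; P]) := by
    intro ω
    rw [quadVar_eq_sum_scaledIncrement hGc]
    simp only [hvar, Finset.sum_sub_distrib, Finset.sum_const, Finset.card_univ, nsmul_eq_mul,
      Fintype.card_coe, ← hN]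
    field_simp
  have hcov : ∑ x : G, ∑ y : G, cov[scaledIncrement ν h m n Y x, scaledIncrement ν h m n Y y; P] ^ 2
      ≤ Real.sqrt (N * A * (n : ℝ) ^ ((d : ℝ) - 9 / 2)) ^ 2 := by
    rw [Real.sq_sqrt (by positivity)]
    have hpt : ∀ x y : G, cov[scaledIncrement ν h m n Y x, scaledIncrement ν h m n Y y; P] ^ 2
        ≤ C ^ 2 * c₁ ^ (-(9 / 2) : ℝ) *
          (1 + n * ‖(x : EuclideanSpace ℝ (Fin d)) - y‖) ^ (-(9 / 2) : ℝ) := by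
      intro x y
      rw [covariance_scaledIncrement hY hnpos hr (hGD x x.2) (hGD y y.2), ← sq_abs]
      have he : ‖r⁻¹ • Matrix.toEuclideanLin M h‖ = 1 := by
        rw [norm_smul, norm_inv, Real.norm_of_nonneg hr.le, ← hrdef, inv_mul_cancel₀ hr.ne']
      set w := (n / r : ℝ) • Matrix.toEuclideanLin M ((x : EuclideanSpace ℝ (Fin d)) - y) with hw
      have h1 := hC n w (r⁻¹ • Matrix.toEuclideanLin M h) hnpos he
      have hwlow : c₁ * (1 + n * ‖(x : EuclideanSpace ℝ (Fin d)) - y‖) ≤ 1 + ‖w‖ := by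
        have h2 := hlow ((x : EuclideanSpace ℝ (Fin d)) - y)
        have h3 : c₀ / r * (n * ‖(x : EuclideanSpace ℝ (Fin d)) - y‖) ≤ ‖w‖ := by
          rw [hw, norm_smul, Real.norm_of_nonneg (by positivity)]
          calc _ = n / r * (c₀ * ‖(x : EuclideanSpace ℝ (Fin d)) - y‖) := by ring
            _ ≤ _ := by gcongr
        rw [mul_add, mul_one]
        refine add_le_add (min_le_left _ _) (le_trans ?_ h3)
        gcongr
        exact min_le_right _ _
      calc _ ≤ (C * (1 + ‖w‖) ^ (-(9 / 4) : ℝ)) ^ 2 := by gcongr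
        _ = C ^ 2 * (1 + ‖w‖) ^ (-(9 / 2) : ℝ) := by
          rw [mul_pow, ← Real.rpow_natCast ((1 + ‖w‖) ^ (-(9 / 4) : ℝ)),
            ← Real.rpow_mul (by positivity)]
          norm_num
        _ ≤ C ^ 2 * (c₁ * (1 + n * ‖(x : EuclideanSpace ℝ (Fin d)) - y‖)) ^ (-(9 / 2) : ℝ) := by
          refine mul_le_mul_of_nonneg_left ?_ (by positivity)
          exact Real.rpow_le_rpow_of_nonpos (by positivity) hwlow (by norm_num)
        _ = _ := by
          rw [Real.mul_rpow hc₁.le (by positivity), mul_assoc]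
    calc _ ≤ ∑ x : G, ∑ y : G, C ^ 2 * c₁ ^ (-(9 / 2) : ℝ) *
          (1 + n * ‖(x : EuclideanSpace ℝ (Fin d)) - y‖) ^ (-(9 / 2) : ℝ) :=
          Finset.sum_le_sum fun x _ => Finset.sum_le_sum fun y _ => hpt x y
      _ ≤ ∑ x : G, C ^ 2 * c₁ ^ (-(9 / 2) : ℝ) * (C₂ * (n : ℝ) ^ ((d : ℝ) - 9 / 2)) := by
          refine Finset.sum_le_sum fun x _ => ?_
          rw [← Finset.mul_sum]
          gcongr
          rw [Finset.sum_coe_sort G (fun y =>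
            (1 + n * ‖(x : EuclideanSpace ℝ (Fin d)) - y‖) ^ (-(9 / 2) : ℝ))]
          exact hC₂ n hnpos x (hGmem x x.2)
      _ = N * (A - 1) * (n : ℝ) ^ ((d : ℝ) - 9 / 2) := by
          rw [Finset.sum_const, Finset.card_univ, Fintype.card_coe, nsmul_eq_mul, ← hN, hA]
          ring
      _ ≤ _ := by
          gcongr
          linarith
  constructor
  · simp only [hQ]
    refine AEMeasurable.const_mul (Finset.aemeasurable_fun_sum _ fun x _ => ?_) _
    exact ((hgauss.eval x).aemeasurable.pow_const 2).sub_const _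
  · have hB : 0 < Real.sqrt (N * A * (n : ℝ) ^ ((d : ℝ) - 9 / 2)) := by
      rw [Real.sqrt_pos]; positivity
    have hmom := lintegral_quadratic_pow_le hgauss
      (fun x => integral_scaledIncrement hY (hGD x x.2)) hB hcov
    simp only [hQ, mul_pow]
    simp_rw [ENNReal.ofReal_mul (by positivity : (0 : ℝ) ≤ ((n : ℝ) ^ 2 / N) ^ 8)]
    rw [lintegral_const_mul' _ _ ENNReal.ofReal_ne_top]
    refine (mul_le_mul_right hmom _).trans ?_
    rw [← ENNReal.ofReal_mul (by positivity)]
    refine ENNReal.ofReal_le_ofReal ?_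
    have h8 : Real.sqrt (N * A * (n : ℝ) ^ ((d : ℝ) - 9 / 2)) ^ 8
        = (N * A * (n : ℝ) ^ ((d : ℝ) - 9 / 2)) ^ 4 := by
      rw [← Real.sq_sqrt (show 0 ≤ N * A * (n : ℝ) ^ ((d : ℝ) - 9 / 2) by positivity), ← pow_mul,
        Real.sqrt_sq (Real.sqrt_nonneg _)]
    -- Against the prefactor `n ^ 16 / N ^ 8`, the power `n ^ 18` leaves `n⁻²`; the remaining `n ^
    -- (4 d) / N ^ 4` is bounded because the grid has at least `c n ^ d` points.
    have hpow : ((n : ℝ) ^ ((d : ℝ) - 9 / 2)) ^ 4 = ((n : ℝ) ^ d) ^ 4 / (n : ℝ) ^ 18 := by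
      rw [← Real.rpow_natCast ((n : ℝ) ^ ((d : ℝ) - 9 / 2)), ← Real.rpow_mul hn'.le,
        show ((d : ℝ) - 9 / 2) * ((4 : ℕ) : ℝ) = ((d * 4 : ℕ) : ℝ) - ((18 : ℕ) : ℝ) by
          push_cast; ring,
        Real.rpow_sub hn', Real.rpow_natCast, Real.rpow_natCast, pow_mul]
    rw [mul_pow 4, h8, mul_pow, mul_pow, hpow]
    calc _ = K * A ^ 4 * (1 / (n : ℝ) ^ 2) * (((n : ℝ) ^ d) ^ 4 / N ^ 4) := by
          rw [hK]
          field_simp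
      _ ≤ K * A ^ 4 * (1 / (n : ℝ) ^ 2) * (1 / c ^ 4) := by
          refine mul_le_mul_of_nonneg_left ?_ (by positivity)
          rw [div_le_div_iff₀ (by positivity) (by positivity), one_mul, ← mul_pow, mul_comm]
          gcongr
      _ = _ := by rw [div_pow]; ring

theorem theorem2 {d : ℕ} {S : Type*} [MeasurableSpace S] (P : Measure S) [IsProbabilityMeasure P]
    (σ α ν : ℝ) (hσ : 0 < σ) (hα : 0 < α) (hν : 0 < ν)
    (M : Matrix (Fin d) (Fin d) ℝ) (hM : M.det = 1)
    (Ω : Set (EuclideanSpace ℝ (Fin d))) (hΩo : IsOpen Ω) (hΩb : Bornology.IsBounded Ω)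
    (hΩne : Ω.Nonempty)
    (h : EuclideanSpace ℝ (Fin d)) (hh : h ≠ 0)
    (p q : ℕ) (hpq : p ≠ q) (hp : ν + 1 < (p : ℝ)) (hq : ν + 1 < (q : ℝ))
    (hp4 : 4 < min (2 * (p : ℝ) - 2 * ν) (d : ℝ))
    (hq4 : 4 < min (2 * (q : ℝ) - 2 * ν) (d : ℝ))
    (D : Set (EuclideanSpace ℝ (Fin d)))
    (hD : ∀ᶠ n : ℕ in atTop, ∀ x ∈ gridPoints Ω n, ∀ k ≤ max p q,
      x + ((k : ℝ) / (n : ℝ)) • h ∈ D)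
    (Y : EuclideanSpace ℝ (Fin d) → S → ℝ) (hY : IsMaternField P σ α ν M D Y) :
    coeffA σ α ν M h q ≠ 0 ∧
    (∀ᵐ ω ∂P, Tendsto
      (fun n : ℕ => (n : ℝ) ^ 2 *
        (quadVar ν Ω h p n (fun t => Y t ω)
          - coeffA σ α ν M h p / coeffA σ α ν M h q * quadVar ν Ω h q n (fun t => Y t ω)))
      atTop
      (𝓝 (coeffB σ α ν M h p
        - coeffA σ α ν M h p / coeffA σ α ν M h q * coeffB σ α ν M h q))) ∧
    coeffB σ α ν M h p - coeffA σ α ν M h p / coeffA σ α ν M h q * coeffB σ α ν M h q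
      = contrastConst ν p q *
        (σ ^ 2 * α ^ (2 * ν + 2) * ‖Matrix.toEuclideanLin M h‖ ^ (2 * ν + 2)) := by
  have hd : 4 < d := by exact_mod_cast (lt_min_iff.1 hp4).2
  have hp2 : ν + 2 < p := by linarith [(lt_min_iff.1 hp4).1]
  have hq2 : ν + 2 < q := by linarith [(lt_min_iff.1 hq4).1]
  have hr : 0 < ‖Matrix.toEuclideanLin M h‖ := by
    obtain ⟨c, hc, hlow⟩ := exists_le_norm_toEuclideanLin hM
    exact (mul_pos hc (norm_pos_iff.2 hh)).trans_le (hlow h)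
  have hSq : 0 < irregularSum ν q := irregularSum_pos hν (by linarith)
  have hK : 0 < σ ^ 2 * α ^ (2 * ν) * ‖Matrix.toEuclideanLin M h‖ ^ (2 * ν) := by positivity
  have hAq : coeffA σ α ν M h q ≠ 0 := (mul_pos hK hSq).ne'
  refine ⟨hAq, ?_, ?_⟩
  · have hDm : ∀ m ≤ max p q, ∀ᶠ n : ℕ in atTop, ∀ x ∈ gridPoints Ω n, ∀ k ≤ m,
        x + ((k : ℝ) / (n : ℝ)) • h ∈ D := fun m hm => hD.mono fun n hn x hx k hk =>
      hn x hx k (hk.trans hm)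
    filter_upwards [ae_tendsto_sq_mul_quadVar_sub hα hν hM hΩo hΩb hΩne hh hp2 hd
        (hDm p (le_max_left _ _)) hY,
      ae_tendsto_sq_mul_quadVar_sub hα hν hM hΩo hΩb hΩne hh hq2 hd
        (hDm q (le_max_right _ _)) hY] with ω hωp hωq
    have hmp := tendsto_sq_mul_altSum_matern_sub (σ := σ) hα hν hr hp
    have hmq := tendsto_sq_mul_altSum_matern_sub (σ := σ) hα hν hr hq
    have hlim := (hωp.add hmp).sub
      ((hωq.add hmq).const_mul (coeffA σ α ν M h p / coeffA σ α ν M h q))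
    simp only [zero_add] at hlim
    refine hlim.congr fun n => ?_
    -- The leading terms cancel exactly in the contrast, so no term of order `n²` is left.
    have hap : σ ^ 2 * α ^ (2 * ν) * ‖Matrix.toEuclideanLin M h‖ ^ (2 * ν) * irregularSum ν p
        = coeffA σ α ν M h p / coeffA σ α ν M h q * (σ ^ 2 * α ^ (2 * ν)
          * ‖Matrix.toEuclideanLin M h‖ ^ (2 * ν) * irregularSum ν q) :=
      (div_mul_cancel₀ (coeffA σ α ν M h p) hAq).symm
    linear_combination (-(n : ℝ) ^ 2) * hap
  · have hratio : coeffA σ α ν M h p / coeffA σ α ν M h q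
        = irregularSum ν p / irregularSum ν q := mul_div_mul_left _ _ hK.ne'
    rw [hratio, coeffB, coeffB, contrastConst]
    ring
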